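/- **Setting.** An instance consists of a finite set of nodes partitioned into depots $\mathcal V_D$, tasks $\mathcal V_T$ and charging stations $\mathcal V_R$; a set $\mathcal A$ of arcs $(i,j)$, $i\ne j$, with times $t(i,j)>0$, costs $c(i,j)>0$ and battery utilizations $b(i,j)>0$; charging costs $\delta(r)>0$ per unit of time for $r\in\mathcal V_R$ (they may differ between stations); a horizon $T$, a battery capacity $B$, and numbers $v^{\mathrm{start}}_j, v^{\mathrm{end}}_j\in\mathbb Z_{\ge 0}$ for $j\in\mathcal V_D$. A path $p$ is a node sequence $n_0,\dots,n_m$ ($m\ge 1$) along arcs, with $n_0,n_m\in\mathcal V_D$ and $n_1,\dots,n_{m-1}\in\mathcal V_T\cup\mathcal V_R$, together with a charging time $\tau_k\ge 0$ for each $k$ with $n_k\in\mathcal V_R$. With $\tau_k:=0$ at the other nodes, the arrival times are $t_0=0$, $t_{k}=t_{k-1}+\tau_{k-1}+t(n_{k-1},n_{k})$, and the charges are $b_0=B$, $b_k=\min\{b_{k-1}+\tau_{k-1},B\}-b(n_{k-1},n_k)$ if $n_{k-1}\in\mathcal V_R$ and $b_k=b_{k-1}-b(n_{k-1},n_k)$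 otherwise. The path is feasible if $t_k\in[0,T]$ and $b_k\in[0,B]$ for $k=1,\dots,m$; its cost is $c^p=\sum_{k<m}\big(c(n_k,n_{k+1})+\mathbb 1[n_k\in\mathcal V_R]\,\delta(n_k)\tau_k\big)$; $\gamma_i^p$ is the number of its visits of $i$. It is elementary if $\gamma_i^p\le 1$ for all $i\in\mathcal V_T$; $\mathcal P_{\mathrm{elem}}$ is the set of elementary feasible paths. For a set $\mathcal P$ of feasible paths, $\mathrm{OPT}(\mathcal P)$ is the optimal value of minimizing $\sum_p c^pz^p$ over finitely supported $z\in\mathbb Z_{\ge0}^{\mathcal P}$ subject to $\sum_{p\text{ starts in }j}z^p=v_j^{\mathrm{start}}$ and $\sum_{p\text{ ends in }j}z^p\ge v_j^{\mathrm{end}}$ for $j\in\mathcal V_D$, and $\sum_p\gamma_i^pz^p=1$ for $i\in\mathcal V_T$; $\overline{\mathrm{OPT}}(\mathcal P)$ is the optimal value of its linear relaxation ($z^p\in\mathbb R_{\ge0}$). An ng-neighborhood is a family $\mathcal N=(N_i)_{i\in\mathcal V}$ with $i\in N_i$, $N_i\subseteq\mathcal V_T$ for $i\in\mathcal V_T$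 and $N_i\subseteq\mathcal V_T\cup\{i\}$ otherwise. $\mathcal P(\mathcal N)$ is the set of feasible paths such that whenever $n_j=n_k$ with $j<k$ there is $j<\ell<k$ with $n_j\notin N_{n_\ell}$. A limited-memory subset-row inequality (lm-SRI cut) is given by $S\subseteq\mathcal V_T$, $S\subseteq M\subseteq\mathcal V$ and weights $w_i\ge0$ ($i\in S$); it reads $\sum_p\tilde\alpha(p)z^p\le\lfloor\sum_{i\in S}w_i\rfloor$, where $\tilde\alpha(p)=\sum_\ell\lfloor\sum_{k\in I_\ell,\,n_k\in S}w_{n_k}\rfloor$ and $I_1,I_2,\dots$ are the maximal blocks of consecutive indices $k$ with $n_k\in M$. Fix any family $\mathcal C$ of lm-SRI cuts (for instance all of them, or those with $|S|=3$ and $w\equiv\frac12$). **Algorithm.** Start with an ng-neighborhood $\mathcal N^0$, cuts $\Omega=\emptyset$, and a finite path set $P\subseteq\mathcal P(\mathcal N^0)$ on which the integer problem is feasible. - *Step 1 (column generation).* Repeat: solve the linear relaxation with the cuts $\Omega$ over $P$, with an optimal primal solution $z$ and an optimal dual solution; if some path in $\mathcal P(\mathcal N)$ has negative reduced cost, add to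 $P$ a nonempty finite set of paths in $\mathcal P(\mathcal N)$ of negative reduced cost, each of minimum cost among the feasible paths with the same node sequence; otherwise go to Step 2 with $z$. - *Step 2.* If $z$ uses only elementary paths and violates no cut of $\mathcal C$, stop and return $z$. - *Step 3.* If $z$ uses a non-elementary path: for all cycles $i,n_1,\dots,n_m,i$ with $i\in\mathcal V_T$ in the node sequences of paths used by $z$, add $i$ to $N_{n_1},\dots,N_{n_m}$; delete from $P$ the paths that are no longer in $\mathcal P(\mathcal N)$; go to Step 1. - *Step 4.* Otherwise add to $\Omega$ a cut of $\mathcal C$ that $z$ violates, and go to Step 1. **Theorem.** Whatever choices are made in these steps, the algorithm terminates after finitely many iterations (including those of column generation) and returns a solution, and so does the algorithm that consists of Steps 1–3 only (the case $\mathcal C=\emptyset$). Steps 1–3 return an optimal solution of the linear relaxation over $\mathcal P_{\mathrm{elem}}$, of value $\overline{\mathrm{OPT}}(\mathcal P_{\mathrm{elem}})$; the same is true in the full algorithm of any solution $z$ obtained from Step 1 that uses only elementary paths while no cut has been added yet. Steps 1–4 return a feasible solution of the linear relaxation over $\mathcal P_{\mathrm{elem}}$ that satisfies all cuts of $\mathcal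 C$ and whose value $\mathrm{OPT}$ satisfies $\overline{\mathrm{OPT}}(\mathcal P_{\mathrm{elem}})\le\mathrm{OPT}\le\mathrm{OPT}(\mathcal P_{\mathrm{elem}})$. -/

import Mathlib

namespace ERSP

noncomputable section

open scoped Classical

/-! ### Instances, paths and their costs -/

/-- An instance of the electric routing-scheduling problem. The nodes are partitioned into depots,
tasks and charging stations (finitely many of each); arcs join distinct nodes and carry a positive
travel time, cost and battery utilization; `chargeCost r` is the (station-dependent) charging cost
per unit of time. `vStart j` machines start in depot `j`, at least `vEnd j` machines end there. -/
structure Instance (V : Type*) where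
  depots : Finset V
  tasks : Finset V
  chargers : Finset V
  cover : ∀ v, v ∈ depots ∨ v ∈ tasks ∨ v ∈ chargers
  disjoint_depots_tasks : Disjoint depots tasks
  disjoint_depots_chargers : Disjoint depots chargers
  disjoint_tasks_chargers : Disjoint tasks chargers
  arc : V → V → Prop
  arc_irrefl : ∀ v, ¬ arc v v
  time : V → V → ℝ
  cost : V → V → ℝ
  battery : V → V → ℝ
  time_pos : ∀ i j, arc i j → 0 < time i j
  cost_pos : ∀ i j, arc i j → 0 < cost i j
  battery_pos : ∀ i j, arc i j → 0 < battery i j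
  chargeCost : V → ℝ
  chargeCost_pos : ∀ r ∈ chargers, 0 < chargeCost r
  horizon : ℝ
  capacity : ℝ
  vStart : V → ℕ
  vEnd : V → ℕ

/-- A node sequence `n₀, …, n_len`. It is stored as a function on `ℕ` that is constant from `len`
on, so that equal sequences are equal terms. -/
structure NodeSeq (V : Type*) where
  len : ℕ
  node : ℕ → V
  pad : ∀ k, len < k → node k = node len

/-- The data of a path: a node sequence and charging times (`τ k` is the time spent charging at
the `k`-th node). -/
structure MachinePath (V : Type*) where
  seq : NodeSeq V
  τ : ℕ → ℝ

variable {V : Type*}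

/-- Number of visits of node `i`. -/
def NodeSeq.visits (U : NodeSeq V) (i : V) : ℕ :=
  ((Finset.range (U.len + 1)).filter (fun k => U.node k = i)).card

/-- Well-formed paths: depot to depot along arcs, no depot in between, nonnegative charging times
at the charging stations (and the value `0` at every index that carries no charging decision). -/
structure Instance.IsPath (I : Instance V) (p : MachinePath V) : Prop where
  one_le_len : 1 ≤ p.seq.len
  arcs : ∀ k < p.seq.len, I.arc (p.seq.node k) (p.seq.node (k + 1))
  first : p.seq.node 0 ∈ I.depots
  last : p.seq.node p.seq.len ∈ I.depots
  middle : ∀ k, 0 < k → k < p.seq.len → p.seq.node k ∈ I.tasks ∨ p.seq.node k ∈ I.chargers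
  τ_nonneg : ∀ k, k < p.seq.len → p.seq.node k ∈ I.chargers → 0 ≤ p.τ k
  τ_zero : ∀ k, ¬ (k < p.seq.len ∧ p.seq.node k ∈ I.chargers) → p.τ k = 0

/-- Time at which the `k`-th node is reached. -/
def Instance.arrivalTime (I : Instance V) (p : MachinePath V) : ℕ → ℝ
  | 0 => 0
  | k + 1 =>
      if p.seq.node k ∈ I.chargers then
        I.arrivalTime p k + p.τ k + I.time (p.seq.node k) (p.seq.node (k + 1))
      else
        I.arrivalTime p k + I.time (p.seq.node k) (p.seq.node (k + 1))

/-- State of charge with which the `k`-th node is reached. -/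
def Instance.arrivalCharge (I : Instance V) (p : MachinePath V) : ℕ → ℝ
  | 0 => I.capacity
  | k + 1 =>
      if p.seq.node k ∈ I.chargers then
        min (I.arrivalCharge p k + p.τ k) I.capacity
          - I.battery (p.seq.node k) (p.seq.node (k + 1))
      else
        I.arrivalCharge p k - I.battery (p.seq.node k) (p.seq.node (k + 1))

/-- The set of all feasible paths. -/
def Instance.feasiblePaths (I : Instance V) : Set (MachinePath V) :=
  {p | I.IsPath p ∧ ∀ k, 1 ≤ k → k ≤ p.seq.len →
    I.arrivalTime p k ∈ Set.Icc 0 I.horizon ∧ I.arrivalCharge p k ∈ Set.Icc 0 I.capacity}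

/-- A node sequence is elementary if it performs every task at most once. -/
def Instance.IsElementary (I : Instance V) (U : NodeSeq V) : Prop :=
  ∀ i ∈ I.tasks, U.visits i ≤ 1

/-- The set of all elementary feasible paths. -/
def Instance.elementaryPaths (I : Instance V) : Set (MachinePath V) :=
  {p | p ∈ I.feasiblePaths ∧ I.IsElementary p.seq}

/-- Travel costs plus charging costs of a path. -/
def Instance.pathCost (I : Instance V) (p : MachinePath V) : ℝ :=
  ∑ k ∈ Finset.range p.seq.len,
    (I.cost (p.seq.node k) (p.seq.node (k + 1)) +
      if p.seq.node k ∈ I.chargers then I.chargeCost (p.seq.node k) * p.τ k else 0)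

/-- A minimal path: a feasible path of least cost among all feasible paths with the same node
sequence (equivalently, the same sequence of subpaths between charging stations), that is, with
optimized charging times. -/
def Instance.IsMinimalPath (I : Instance V) (p : MachinePath V) : Prop :=
  p ∈ I.feasiblePaths ∧ ∀ p' ∈ I.feasiblePaths, p'.seq = p.seq → I.pathCost p ≤ I.pathCost p'

/-! ### ng-neighborhoods -/

structure Instance.IsNgNeighborhood (I : Instance V) (N : V → Set V) : Prop where
  self_mem : ∀ i, i ∈ N i
  of_task : ∀ i ∈ I.tasks, ∀ v ∈ N i, v ∈ I.tasks
  of_nontask : ∀ i, i ∉ I.tasks → ∀ v ∈ N i, v ∈ I.tasks ∨ v = i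

def IsNgFeasible (N : V → Set V) (U : NodeSeq V) : Prop :=
  ∀ j k, j < k → k ≤ U.len → U.node j = U.node k →
    ∃ l, j < l ∧ l < k ∧ U.node j ∉ N (U.node l)

/-- The ng-feasible paths. -/
def Instance.ngPaths (I : Instance V) (N : V → Set V) : Set (MachinePath V) :=
  {p | p ∈ I.feasiblePaths ∧ IsNgFeasible N p.seq}

/-! ### Limited-memory subset-row inequalities -/

/-- The parameters `(S, M, w)` of an lm-SRI cut: tasks `S`, memory `M ⊇ S`, and nonnegative weights
on `S` (extended by `0`). -/
structure Instance.Cut (I : Instance V) where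
  S : Finset V
  M : Finset V
  w : V → ℝ
  S_tasks : S ⊆ I.tasks
  S_memory : S ⊆ M
  w_nonneg : ∀ i ∈ S, 0 ≤ w i
  w_zero : ∀ i ∉ S, w i = 0

/-- `{a, …, b}` is a maximal block of consecutive indices of `U` whose nodes lie in `M`. -/
def NodeSeq.IsBlock (U : NodeSeq V) (M : Finset V) (a b : ℕ) : Prop :=
  a ≤ b ∧ b ≤ U.len ∧ (∀ k, a ≤ k → k ≤ b → U.node k ∈ M) ∧
    (a = 0 ∨ U.node (a - 1) ∉ M) ∧ (b = U.len ∨ U.node (b + 1) ∉ M)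

/-- The lm-SRI coefficient of a node sequence: the sum over the maximal blocks of the rounded-down
weights of the visits to `S`. -/
def Instance.Cut.coeff {I : Instance V} (q : I.Cut) (U : NodeSeq V) : ℤ :=
  ∑ ab ∈ ((Finset.range (U.len + 1)) ×ˢ (Finset.range (U.len + 1))).filter
      (fun ab => U.IsBlock q.M ab.1 ab.2),
    ⌊∑ k ∈ Finset.Icc ab.1 ab.2, if U.node k ∈ q.S then q.w (U.node k) else 0⌋

/-- The right-hand side of a cut. -/
def Instance.Cut.rhs {I : Instance V} (q : I.Cut) : ℤ := ⌊∑ i ∈ q.S, q.w i⌋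

/-- The cut is satisfied by `z`. -/
def Instance.Cut.Satisfied {I : Instance V} (q : I.Cut) (z : MachinePath V →₀ ℝ) : Prop :=
  z.sum (fun p x => (q.coeff p.seq : ℝ) * x) ≤ q.rhs

/-! ### The path-based formulation and its relaxation -/

/-- The objective; the variables `z` have finite support. -/
def Instance.objective (I : Instance V) (z : MachinePath V →₀ ℝ) : ℝ :=
  z.sum (fun p x => I.pathCost p * x)

/-- Feasible solutions of the linear relaxation over the path set `P`, tightened by the cuts `Ω`. -/
structure Instance.RelaxFeasible (I : Instance V) (P : Set (MachinePath V)) (Ω : Set I.Cut)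
    (z : MachinePath V →₀ ℝ) : Prop where
  support : ∀ p ∈ z.support, p ∈ P
  nonneg : ∀ p, 0 ≤ z p
  start : ∀ j ∈ I.depots,
    z.sum (fun p x => (if p.seq.node 0 = j then (1 : ℝ) else 0) * x) = I.vStart j
  finish : ∀ j ∈ I.depots,
    (I.vEnd j : ℝ) ≤ z.sum (fun p x => (if p.seq.node p.seq.len = j then (1 : ℝ) else 0) * x)
  serve : ∀ i ∈ I.tasks, z.sum (fun p x => (p.seq.visits i : ℝ) * x) = 1
  cuts : ∀ q ∈ Ω, q.Satisfied z

/-- Feasible solutions of the integer problem over the path set `P`. -/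
def Instance.IntFeasible (I : Instance V) (P : Set (MachinePath V)) (z : MachinePath V →₀ ℝ) :
    Prop :=
  I.RelaxFeasible P ∅ z ∧ ∀ p, ∃ n : ℕ, z p = n

/-- Optimal value of the linear relaxation over `P` (without cuts; `⊤` if infeasible). -/
def Instance.relaxOpt (I : Instance V) (P : Set (MachinePath V)) : EReal :=
  ⨅ z ∈ {z | I.RelaxFeasible P ∅ z}, (I.objective z : EReal)

/-- Optimal value of the integer problem over `P` (`⊤` if infeasible). -/
def Instance.intOpt (I : Instance V) (P : Set (MachinePath V)) : EReal :=
  ⨅ z ∈ {z | I.IntFeasible P z}, (I.objective z : EReal)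

/-- Dual variables of the start, end, task and cut constraints. -/
structure Instance.Dual (I : Instance V) where
  κ : V → ℝ
  μ : V → ℝ
  ν : V → ℝ
  lam : I.Cut → ℝ

/-- The reduced cost of a path. -/
def Instance.reducedCost (I : Instance V) (Ω : Finset I.Cut) (y : I.Dual) (p : MachinePath V) : ℝ :=
  I.pathCost p
    - ∑ j ∈ I.depots, (if p.seq.node 0 = j then (1 : ℝ) else 0) * y.κ j
    - ∑ j ∈ I.depots, (if p.seq.node p.seq.len = j then (1 : ℝ) else 0) * y.μ j
    - ∑ i ∈ I.tasks, (p.seq.visits i : ℝ) * y.ν i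
    - ∑ q ∈ Ω, y.lam q * (q.coeff p.seq : ℝ)

/-- Feasibility in the linear programming dual of the restricted master problem. -/
structure Instance.DualFeasible (I : Instance V) (P : Finset (MachinePath V)) (Ω : Finset I.Cut)
    (y : I.Dual) : Prop where
  μ_nonneg : ∀ j ∈ I.depots, 0 ≤ y.μ j
  lam_nonpos : ∀ q ∈ Ω, y.lam q ≤ 0
  reducedCost_nonneg : ∀ p ∈ P, 0 ≤ I.reducedCost Ω y p

def Instance.dualObjective (I : Instance V) (Ω : Finset I.Cut) (y : I.Dual) : ℝ :=
  ∑ j ∈ I.depots, (I.vStart j : ℝ) * y.κ j + ∑ j ∈ I.depots, (I.vEnd j : ℝ) * y.μ j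
    + ∑ i ∈ I.tasks, y.ν i + ∑ q ∈ Ω, (q.rhs : ℝ) * y.lam q

/-- `z` is an optimal solution of the restricted master problem over the finite path set `P`. -/
def Instance.PrimalOptimal (I : Instance V) (P : Finset (MachinePath V)) (Ω : Finset I.Cut)
    (z : MachinePath V →₀ ℝ) : Prop :=
  I.RelaxFeasible (P : Set (MachinePath V)) (Ω : Set I.Cut) z ∧
    ∀ z', I.RelaxFeasible (P : Set (MachinePath V)) (Ω : Set I.Cut) z' →
      I.objective z ≤ I.objective z'

/-- `y` is an optimal dual solution of the restricted master problem. -/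
def Instance.DualOptimal (I : Instance V) (P : Finset (MachinePath V)) (Ω : Finset I.Cut)
    (y : I.Dual) : Prop :=
  I.DualFeasible P Ω y ∧ ∀ y', I.DualFeasible P Ω y' →
    I.dualObjective Ω y' ≤ I.dualObjective Ω y

/-! ### The augmented column generation algorithm -/

/-- All paths used by `z` are elementary. -/
def Instance.UsesElementary (I : Instance V) (z : MachinePath V →₀ ℝ) : Prop :=
  ∀ p ∈ z.support, I.IsElementary p.seq

/-- Expansion of the ng-neighborhood: for every cycle `i, n₁, …, n_m, i` at a task `i` in a
(necessarily non-elementary) path used by `z`, the task `i` is added to the neighborhoods of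
`n₁, …, n_m`. -/
def Instance.expand (I : Instance V) (N : V → Set V) (z : MachinePath V →₀ ℝ) : V → Set V :=
  fun v => N v ∪ {i | i ∈ I.tasks ∧ ∃ p ∈ z.support, ∃ j l k, j < l ∧ l < k ∧ k ≤ p.seq.len ∧
    p.seq.node j = i ∧ p.seq.node k = i ∧ p.seq.node l = v}

/-- States of the algorithm: within column generation (with current neighborhoods, cuts, and
generated paths); after column generation, with its solution `z`; and after termination. -/
inductive Instance.State (I : Instance V) where
  | generating (N : V → Set V) (Ω : Finset I.Cut) (P : Finset (MachinePath V))
  | optimized (N : V → Set V) (Ω : Finset I.Cut) (P : Finset (MachinePath V))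
      (z : MachinePath V →₀ ℝ)
  | returned (z : MachinePath V →₀ ℝ)

/-- One step of the algorithm, with cuts separated over the family `C`.

* `price`, `optimal` (Step 1, column generation): solve the restricted master problem and let `y` be
  any optimal dual solution; either add any nonempty finite set of minimal ng-feasible paths of
  negative reduced cost, or, if no ng-feasible path has negative reduced cost, end with any optimal
  solution `z` of the restricted master problem.
* `terminate` (Step 2): return `z` if it uses elementary paths only and violates no cut.
* `elementarity` (Step 3): if `z` uses a non-elementary path, expand the ng-neighborhoods, keep the
  paths that remain ng-feasible and resume column generation.
* `integrality` (Step 4): otherwise add any violated cut and resume column generation. -/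
inductive Instance.Step (I : Instance V) (C : Set I.Cut) : I.State → I.State → Prop
  | price (N : V → Set V) (Ω : Finset I.Cut) (P Pnew : Finset (MachinePath V)) (y : I.Dual)
      (hy : I.DualOptimal P Ω y) (hne : Pnew.Nonempty)
      (hnew : ∀ p ∈ Pnew, p ∈ I.ngPaths N ∧ I.IsMinimalPath p ∧ I.reducedCost Ω y p < 0) :
      I.Step C (.generating N Ω P) (.generating N Ω (P ∪ Pnew))
  | optimal (N : V → Set V) (Ω : Finset I.Cut) (P : Finset (MachinePath V)) (y : I.Dual)
      (z : MachinePath V →₀ ℝ) (hy : I.DualOptimal P Ω y) (hz : I.PrimalOptimal P Ω z)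
      (hnone : ∀ p ∈ I.ngPaths N, 0 ≤ I.reducedCost Ω y p) :
      I.Step C (.generating N Ω P) (.optimized N Ω P z)
  | terminate (N : V → Set V) (Ω : Finset I.Cut) (P : Finset (MachinePath V))
      (z : MachinePath V →₀ ℝ) (helem : I.UsesElementary z) (hcuts : ∀ q ∈ C, q.Satisfied z) :
      I.Step C (.optimized N Ω P z) (.returned z)
  | elementarity (N : V → Set V) (Ω : Finset I.Cut) (P : Finset (MachinePath V))
      (z : MachinePath V →₀ ℝ) (helem : ¬ I.UsesElementary z) :
      I.Step C (.optimized N Ω P z)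
        (.generating (I.expand N z) Ω (P.filter (fun p => p ∈ I.ngPaths (I.expand N z))))
  | integrality (N : V → Set V) (Ω : Finset I.Cut) (P : Finset (MachinePath V))
      (z : MachinePath V →₀ ℝ) (q : I.Cut) (helem : I.UsesElementary z) (hq : q ∈ C)
      (hviol : ¬ q.Satisfied z) :
      I.Step C (.optimized N Ω P z) (.generating N (insert q Ω) P)

/-- `s` occurs in some run that starts in `s₀`. -/
def Instance.Reaches (I : Instance V) (C : Set I.Cut) (s₀ s : I.State) : Prop :=
  Relation.ReflTransGen (I.Step C) s₀ s

/-- Every run that starts in `s₀` ends after finitely many steps, by returning a solution: there is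
no infinite run, and a run can be stuck only in a state in which a solution has been returned. -/
def Instance.Terminates (I : Instance V) (C : Set I.Cut) (s₀ : I.State) : Prop :=
  (¬ ∃ s : ℕ → I.State, s 0 = s₀ ∧ ∀ k, I.Step C (s k) (s (k + 1))) ∧
    ∀ s, I.Reaches C s₀ s → (∃ z, s = .returned z) ∨ ∃ s', I.Step C s s'

end

end ERSP

/-! Termination. Charging times are real, so there may be infinitely many feasible paths. But travel
times on arcs are bounded below by a positive constant and the horizon bounds the duration, so only
finitely many node sequences occur (`Instance.finite_feasible_seq`). For a fixed sequence the
feasible charging times are compact, so a minimal path exists (`Instance.exists_isMinimalPath`).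
Paths with the same sequence differ in reduced cost only by their cost; hence a minimal path of
negative reduced cost has a sequence for which no minimal path was present, and column generation
stops. Each expansion adds one of finitely many pairs to the neighborhoods. The family of cuts may
be infinite, but under the task constraints the integer parts of the weights cancel; what remains of
a cut is a bounded integer for each of the finitely many sequences and a bounded right-hand side,
its `signature`. A violated cut has a new signature. These counts, ordered lexicographically,
decrease.

No run gets stuck. The paths of the initial integer solution are elementary, hence ng-feasible for
all neighborhoods and never deleted, and that solution satisfies every lm-SRI cut by Chvátal-Gomory
rounding. So the restricted master problem stays feasible; its costs are nonnegative, and linear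
programming duality, derived from Farkas' lemma, gives optimal primal and dual solutions.

Bounds. When column generation ends, no ng-feasible path, hence no elementary path, has negative
reduced cost. Weak duality then bounds the objective by that of every elementary solution satisfying
the current cuts, in particular every integer one. -/

namespace ERSP

open scoped Classical

/-! ### Farkas' lemma and linear programming duality -/

/-- **Farkas' lemma** for finitely many linear functionals on an arbitrary real vector space. -/
theorem farkas {ι W : Type*} [AddCommGroup W] [Module ℝ W] (s : Finset ι)
    (a : ι → W →ₗ[ℝ] ℝ) (b : W →ₗ[ℝ] ℝ) :
    (∃ u : ι → ℝ, (∀ i ∈ s, 0 ≤ u i) ∧ b = ∑ i ∈ s, u i • a i) ∨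
      ∃ x, (∀ i ∈ s, a i x ≤ 0) ∧ 0 < b x := by
  induction s using Finset.induction_on generalizing a b with
  | empty =>
    by_cases hb : b = 0
    · exact Or.inl ⟨0, by simp, by simpa using hb⟩
    · right
      obtain ⟨x, hx⟩ : ∃ x, b x ≠ 0 := by
        by_contra! h
        exact hb (LinearMap.ext h)
      rcases lt_or_gt_of_ne hx with h | h
      · exact ⟨-x, by simp, by simpa using h⟩
      · exact ⟨x, by simp, h⟩
  | insert i₀ s hi₀ ih =>
    have hne : ∀ i ∈ s, i ≠ i₀ := fun i hi h => hi₀ (h ▸ hi)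
    rcases ih a b with ⟨u, hu, hb⟩ | ⟨x, hx, hbx⟩
    · refine Or.inl ⟨Function.update u i₀ 0, ?_, ?_⟩
      · intro i hi
        rcases Finset.mem_insert.1 hi with rfl | hi
        · simp
        · simpa [hne i hi] using hu i hi
      · rw [Finset.sum_insert hi₀, hb]
        simp only [Function.update_self, zero_smul, zero_add]
        exact Finset.sum_congr rfl fun i hi => by simp [hne i hi]
    by_cases h0 : a i₀ x ≤ 0
    · refine Or.inr ⟨x, ?_, hbx⟩
      intro i hi
      rcases Finset.mem_insert.1 hi with rfl | hi
      · exact h0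
      · exact hx i hi
    push Not at h0
    set c := (a i₀ x)⁻¹ with hc
    have hcpos : 0 < c := inv_pos.2 h0
    have hc1 : c * a i₀ x = 1 := inv_mul_cancel₀ h0.ne'
    -- Compose all functionals with the projection `v ↦ v - (c * a i₀ v) • x` along `x` onto the
    -- kernel of `a i₀`. A combination for these becomes one for the original functionals, whose
    -- coefficient at `a i₀` is nonnegative because `b x > 0 ≥ a i x`; a separating vector is
    -- projected to the kernel.
    rcases ih (fun i => a i - (c * a i x) • a i₀) (b - (c * b x) • a i₀) with
      ⟨u, hu, hb⟩ | ⟨x', hx', hbx'⟩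
    · refine Or.inl ⟨Function.update u i₀ (c * b x - ∑ i ∈ s, u i * (c * a i x)), ?_, ?_⟩
      · intro i hi
        rcases Finset.mem_insert.1 hi with rfl | hi
        · have h1 : ∑ j ∈ s, u j * (c * a j x) ≤ 0 := Finset.sum_nonpos fun j hj =>
            mul_nonpos_of_nonneg_of_nonpos (hu j hj)
              (mul_nonpos_of_nonneg_of_nonpos hcpos.le (hx j hj))
          have h2 : 0 < c * b x := mul_pos hcpos hbx
          simp only [Function.update_self]
          linarith
        · simpa [hne i hi] using hu i hi
      · rw [Finset.sum_insert hi₀]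
        have h1 : ∑ i ∈ s, Function.update u i₀ (c * b x - ∑ i ∈ s, u i * (c * a i x)) i • a i
            = ∑ i ∈ s, u i • a i :=
          Finset.sum_congr rfl fun i hi => by simp [hne i hi]
        rw [h1, Function.update_self]
        refine LinearMap.ext fun y => ?_
        have h2 := LinearMap.congr_fun hb y
        simp only [LinearMap.sub_apply, LinearMap.smul_apply, LinearMap.sum_apply, smul_eq_mul,
          mul_sub, Finset.sum_sub_distrib] at h2
        simp only [LinearMap.add_apply, LinearMap.smul_apply, LinearMap.sum_apply, smul_eq_mul,
          sub_mul, Finset.sum_mul]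
        have h3 : ∑ i ∈ s, u i * (c * a i x * a i₀ y) = ∑ i ∈ s, u i * (c * a i x) * a i₀ y :=
          Finset.sum_congr rfl fun i _ => by ring
        linarith
    · refine Or.inr ⟨x' - (c * a i₀ x') • x, ?_, ?_⟩
      · intro i hi
        rcases Finset.mem_insert.1 hi with rfl | hi
        · have : a i (x' - (c * a i x') • x) = a i x' - (c * a i x) * a i x' := by
            simp; ring
          rw [this, hc1]; simp
        · have h := hx' i hi
          simp at h ⊢
          linarith [mul_right_comm c (a i x) (a i₀ x'), mul_right_comm c (a i₀ x') (a i x)]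
      · simp at hbx' ⊢
        linarith [mul_right_comm c (b x) (a i₀ x'), mul_right_comm c (a i₀ x') (b x)]

/-- **Strong duality** of linear programming: if the minimization of `c` subject to the constraints
`β i ≤ g i x` is feasible and bounded, then there are an optimal solution and a dual certificate
of the same value. -/
theorem exists_optimal_and_certificate {ι W : Type*} [AddCommGroup W] [Module ℝ W] (s : Finset ι)
    (g : ι → W →ₗ[ℝ] ℝ) (β : ι → ℝ) (c : W →ₗ[ℝ] ℝ) (m : ℝ)
    (hfeas : ∃ x, ∀ i ∈ s, β i ≤ g i x) (hbdd : ∀ x, (∀ i ∈ s, β i ≤ g i x) → m ≤ c x) :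
    ∃ x, (∀ i ∈ s, β i ≤ g i x) ∧ ∃ u : ι → ℝ, (∀ i ∈ s, 0 ≤ u i) ∧
      (∀ w, c w = ∑ i ∈ s, u i * g i w) ∧ ∑ i ∈ s, u i * β i = c x := by
  set F : Set W := {x | ∀ i ∈ s, β i ≤ g i x} with hF
  have hbelow : BddBelow (c '' F) := ⟨m, by rintro _ ⟨x, hx, rfl⟩; exact hbdd x hx⟩
  have hne : (c '' F).Nonempty := by
    obtain ⟨x, hx⟩ := hfeas
    exact ⟨_, x, hx, rfl⟩
  set v := sInf (c '' F) with hv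
  have hvle : ∀ x ∈ F, v ≤ c x := fun x hx => csInf_le hbelow ⟨x, hx, rfl⟩
  -- For `(x, t)`: the inequalities `β i * t ≤ g i x`, homogenized.
  let G : ι → W × ℝ →ₗ[ℝ] ℝ := fun i =>
    (β i) • LinearMap.snd ℝ W ℝ - (g i).comp (LinearMap.fst ℝ W ℝ)
  let C : W × ℝ →ₗ[ℝ] ℝ := c.comp (LinearMap.fst ℝ W ℝ) - v • LinearMap.snd ℝ W ℝ
  let A : Option (Option ι) → W × ℝ →ₗ[ℝ] ℝ := fun o =>
    match o with
    | none => C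
    | some none => - LinearMap.snd ℝ W ℝ
    | some (some i) => G i
  have hG : ∀ i p, G i p = β i * p.2 - g i p.1 := fun i p => by simp [G]
  have hC : ∀ p, C p = c p.1 - v * p.2 := fun p => by simp [C]
  have hscale : ∀ x : W, ∀ t : ℝ, 0 < t → (∀ i ∈ s, β i * t ≤ g i x) → t⁻¹ • x ∈ F := by
    intro x t ht h i hi
    rw [map_smul, smul_eq_mul, inv_mul_eq_div, le_div_iff₀ ht]
    exact h i hi
  obtain ⟨x₀, hx₀F, hx₀⟩ : ∃ x ∈ F, c x = v := by
    -- Attainment: a point with `t > 0` in the cone where `C`, `-t` and all `G i` are nonpositive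
    -- rescales to a minimizer. Otherwise `t` is a nonnegative combination of these forms; at `(x,
    -- 1)` with `x ∈ F` this gives `1 ≤ u none * (c x - v)`, a uniform gap above the infimum `v`.
    rcases farkas (Finset.insertNone (Finset.insertNone s)) A (LinearMap.snd ℝ W ℝ) with
      ⟨u, hu, hsum⟩ | ⟨⟨x, t⟩, hx, ht⟩
    · exfalso
      have hall : ∀ p : W × ℝ, p.2 = u none * (c p.1 - v * p.2) + (-(u (some none) * p.2)
          + ∑ i ∈ s, u (some (some i)) * (β i * p.2 - g i p.1)) := by
        intro p
        have := LinearMap.congr_fun hsum p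
        simpa [Finset.sum_insertNone, A, hG, hC] using this
      have hu0 : 0 ≤ u none := hu _ (by simp)
      have hu1 : 0 ≤ u (some none) := hu _ (by simp)
      have hu2 : ∀ i ∈ s, 0 ≤ u (some (some i)) := fun i hi => hu _ (by simpa using hi)
      have key : ∀ x ∈ F, 1 ≤ u none * (c x - v) := by
        intro x hx
        have h := hall (x, 1)
        have h3 : ∑ i ∈ s, u (some (some i)) * (β i * 1 - g i x) ≤ 0 :=
          Finset.sum_nonpos fun i hi => mul_nonpos_of_nonneg_of_nonpos (hu2 i hi)
            (by linarith [hx i hi])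
        simp only [mul_one] at h h3
        linarith
      rcases hu0.eq_or_lt with h0 | h0
      · obtain ⟨_, x, hx, rfl⟩ := hne
        have := key x hx
        rw [← h0] at this
        linarith
      · have hlow : v + (u none)⁻¹ ≤ v := by
          conv_rhs => rw [hv]
          refine le_csInf hne ?_
          rintro _ ⟨x, hx, rfl⟩
          have := key x hx
          have h4 : (u none)⁻¹ ≤ c x - v := by
            rw [inv_le_iff_one_le_mul₀ h0]
            linarith
          linarith
        linarith [inv_pos.2 h0]
    · have ht : 0 < t := by simpa using ht
      have h1 : ∀ i ∈ s, β i * t ≤ g i x := fun i hi => by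
        have := hx (some (some i)) (by simpa using hi)
        simp only [A, hG] at this
        linarith
      have h2 : c x ≤ v * t := by
        have := hx none (by simp)
        simp only [A, hC] at this
        linarith
      have hF' := hscale x t ht h1
      refine ⟨_, hF', le_antisymm ?_ (hvle _ hF')⟩
      rw [map_smul, smul_eq_mul, inv_mul_eq_div, div_le_iff₀ ht]
      exact h2
  refine ⟨x₀, hx₀F, ?_⟩
  -- Certificate: `-C` is a combination of `-t` and the `G i`, read off at `t = 0` for the identity
  -- and at `(0, 1)` for the value. A separating `(x, t)` would beat `v`: after rescaling if `t >
  -- 0`, as a direction added to `x₀` if `t = 0`.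
  rcases farkas (Finset.insertNone s) (fun o => A (some o)) (-C) with
    ⟨u, hu, hsum⟩ | ⟨⟨x, t⟩, hx, ht⟩
  · have hall : ∀ p : W × ℝ, v * p.2 - c p.1 = -(u none * p.2)
          + ∑ i ∈ s, u (some i) * (β i * p.2 - g i p.1) := by
      intro p
      have := LinearMap.congr_fun hsum p
      simpa [Finset.sum_insertNone, A, hG, hC] using this
    have hu1 : 0 ≤ u none := hu _ (by simp)
    have hu2 : ∀ i ∈ s, 0 ≤ u (some i) := fun i hi => hu _ (by simpa using hi)
    have hc : ∀ w, c w = ∑ i ∈ s, u (some i) * g i w := by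
      intro w
      have h := hall (w, 0)
      simp only [mul_zero, zero_sub, mul_neg, Finset.sum_neg_distrib, neg_zero, zero_add] at h
      linarith
    refine ⟨fun i => u (some i), hu2, hc, le_antisymm ?_ ?_⟩
    · rw [hc]
      exact Finset.sum_le_sum fun i hi => mul_le_mul_of_nonneg_left (hx₀F i hi) (hu2 i hi)
    · have h := hall (0, 1)
      simp only [mul_one, map_zero, sub_zero] at h
      linarith
  · exfalso
    have h1 : ∀ i ∈ s, β i * t ≤ g i x := fun i hi => by
      have := hx (some i) (by simpa using hi)
      simp only [A, hG] at this
      linarith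
    have h2 : 0 ≤ t := by simpa [A] using hx none (by simp)
    have h3 : c x < v * t := by
      simp only [LinearMap.neg_apply, hC] at ht
      linarith
    rcases h2.eq_or_lt with rfl | h2
    · have : x₀ + x ∈ F := fun i hi => by
        rw [map_add]
        linarith [h1 i hi, hx₀F i hi]
      have := hvle _ this
      rw [map_add] at this
      linarith
    · have := hvle _ (hscale x t h2 h1)
      rw [map_smul, smul_eq_mul, inv_mul_eq_div, le_div_iff₀ h2] at this
      linarith

/-! ### Duality for the restricted master problem -/

variable {V : Type*}

/-- The reduced costs, weighted by `z`, in terms of the left-hand sides of the constraints. -/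
theorem Instance.sum_reducedCost (I : Instance V) (Ω : Finset I.Cut) (y : I.Dual)
    (z : MachinePath V →₀ ℝ) :
    z.sum (fun p x => I.reducedCost Ω y p * x) = I.objective z
      - ∑ j ∈ I.depots, y.κ j * z.sum (fun p x => (if p.seq.node 0 = j then (1 : ℝ) else 0) * x)
      - ∑ j ∈ I.depots,
          y.μ j * z.sum (fun p x => (if p.seq.node p.seq.len = j then (1 : ℝ) else 0) * x)
      - ∑ i ∈ I.tasks, y.ν i * z.sum (fun p x => (p.seq.visits i : ℝ) * x)
      - ∑ q ∈ Ω, y.lam q * z.sum (fun p x => (q.coeff p.seq : ℝ) * x) := by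
  have swap : ∀ {α : Type _} (s : Finset α) (r : α → ℝ) (f : α → MachinePath V → ℝ),
      ∑ j ∈ s, r j * z.sum (fun p x => f j p * x)
        = ∑ p ∈ z.support, (∑ j ∈ s, f j p * r j) * z p := by
    intro α s r f
    simp only [Finsupp.sum, Finset.mul_sum, Finset.sum_mul]
    rw [Finset.sum_comm]
    exact Finset.sum_congr rfl fun _ _ => Finset.sum_congr rfl fun _ _ => by ring
  rw [swap I.depots y.κ (fun j p => if p.seq.node 0 = j then (1 : ℝ) else 0),
    swap I.depots y.μ (fun j p => if p.seq.node p.seq.len = j then (1 : ℝ) else 0),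
    swap I.tasks y.ν (fun i p => (p.seq.visits i : ℝ)),
    swap Ω y.lam (fun q p => (q.coeff p.seq : ℝ))]
  simp only [Instance.objective, Finsupp.sum, ← Finset.sum_sub_distrib]
  refine Finset.sum_congr rfl fun p _ => ?_
  simp only [Instance.reducedCost, sub_mul]
  congr 2
  exact Finset.sum_congr rfl fun _ _ => by ring

/-- **Weak duality**, for solutions over paths of nonnegative reduced cost. -/
theorem Instance.dualObjective_le_objective (I : Instance V) {Q : Set (MachinePath V)}
    {Ω : Finset I.Cut} {y : I.Dual} {z : MachinePath V →₀ ℝ} (hz : I.RelaxFeasible Q Ω z)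
    (hμ : ∀ j ∈ I.depots, 0 ≤ y.μ j) (hlam : ∀ q ∈ Ω, y.lam q ≤ 0)
    (hred : ∀ p ∈ Q, 0 ≤ I.reducedCost Ω y p) :
    I.dualObjective Ω y ≤ I.objective z := by
  have h0 : 0 ≤ z.sum (fun p x => I.reducedCost Ω y p * x) :=
    Finset.sum_nonneg fun p hp => mul_nonneg (hred p (hz.support p hp)) (hz.nonneg p)
  rw [I.sum_reducedCost] at h0
  have h1 : ∑ j ∈ I.depots, (I.vStart j : ℝ) * y.κ j = ∑ j ∈ I.depots,
      y.κ j * z.sum (fun p x => (if p.seq.node 0 = j then (1 : ℝ) else 0) * x) :=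
    Finset.sum_congr rfl fun j hj => by rw [hz.start j hj, mul_comm]
  have h2 : ∑ j ∈ I.depots, (I.vEnd j : ℝ) * y.μ j ≤ ∑ j ∈ I.depots,
      y.μ j * z.sum (fun p x => (if p.seq.node p.seq.len = j then (1 : ℝ) else 0) * x) :=
    Finset.sum_le_sum fun j hj => by
      rw [mul_comm]
      exact mul_le_mul_of_nonneg_left (hz.finish j hj) (hμ j hj)
  have h3 : ∑ i ∈ I.tasks, y.ν i = ∑ i ∈ I.tasks,
      y.ν i * z.sum (fun p x => (p.seq.visits i : ℝ) * x) :=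
    Finset.sum_congr rfl fun i hi => by rw [hz.serve i hi, mul_one]
  have h4 : ∑ q ∈ Ω, (q.rhs : ℝ) * y.lam q ≤ ∑ q ∈ Ω,
      y.lam q * z.sum (fun p x => (q.coeff p.seq : ℝ) * x) :=
    Finset.sum_le_sum fun q hq => by
      rw [mul_comm]
      exact mul_le_mul_of_nonpos_left (hz.cuts q hq) (hlam q hq)
  unfold Instance.dualObjective
  linarith

/-- The linear form `∑ p ∈ P, a p * x p`. -/
noncomputable def rowForm (P : Finset (MachinePath V)) (a : MachinePath V → ℝ) :
    (MachinePath V → ℝ) →ₗ[ℝ] ℝ :=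
  ∑ p ∈ P, a p • LinearMap.proj p

theorem rowForm_apply (P : Finset (MachinePath V)) (a x : MachinePath V → ℝ) :
    rowForm P a x = ∑ p ∈ P, a p * x p := by
  simp [rowForm]

theorem rowForm_single {P : Finset (MachinePath V)} (a : MachinePath V → ℝ) {p : MachinePath V}
    (hp : p ∈ P) : rowForm P a (Pi.single p 1) = a p := by
  simp [rowForm_apply, Pi.single_apply, hp]

theorem rowForm_eq_sum {P : Finset (MachinePath V)} (a : MachinePath V → ℝ)
    {z : MachinePath V →₀ ℝ} (hz : z.support ⊆ P) :
    rowForm P a z = z.sum (fun p x => a p * x) := by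
  rw [rowForm_apply, Finsupp.sum_of_support_subset z hz _ (by simp)]

/-- The restricted master problem, if feasible, has primal and dual solutions of equal value. -/
theorem Instance.exists_primal_dual (I : Instance V) {P : Finset (MachinePath V)}
    {Ω : Finset I.Cut} (hcost : ∀ p ∈ P, 0 ≤ I.pathCost p)
    (hfeas : ∃ z, I.RelaxFeasible (P : Set (MachinePath V)) (Ω : Set I.Cut) z) :
    ∃ z y, I.RelaxFeasible (P : Set (MachinePath V)) (Ω : Set I.Cut) z ∧
      I.DualFeasible P Ω y ∧ I.dualObjective Ω y = I.objective z := by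
  let start : V → MachinePath V → ℝ := fun j p => if p.seq.node 0 = j then (1 : ℝ) else 0
  let finish : V → MachinePath V → ℝ := fun j p => if p.seq.node p.seq.len = j then (1 : ℝ) else 0
  let serve : V → MachinePath V → ℝ := fun i p => (p.seq.visits i : ℝ)
  let cut : I.Cut → MachinePath V → ℝ := fun q p => (q.coeff p.seq : ℝ)
  -- Everything is put in the form `β ≤ g x`: start and task equalities become two inequalities
  -- each, cuts are negated, and the last summand holds the sign constraints on the variables.
  let s : Finset (V ⊕ V ⊕ V ⊕ V ⊕ V ⊕ I.Cut ⊕ MachinePath V) :=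
    I.depots.disjSum (I.depots.disjSum (I.depots.disjSum (I.tasks.disjSum (I.tasks.disjSum
      (Ω.disjSum P)))))
  let g : V ⊕ V ⊕ V ⊕ V ⊕ V ⊕ I.Cut ⊕ MachinePath V → (MachinePath V → ℝ) →ₗ[ℝ] ℝ :=
    Sum.elim (fun j => rowForm P (start j)) <| Sum.elim (fun j => -rowForm P (start j)) <|
    Sum.elim (fun j => rowForm P (finish j)) <| Sum.elim (fun i => rowForm P (serve i)) <|
    Sum.elim (fun i => -rowForm P (serve i)) <| Sum.elim (fun q => -rowForm P (cut q)) <|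
    fun p => LinearMap.proj p
  let β : V ⊕ V ⊕ V ⊕ V ⊕ V ⊕ I.Cut ⊕ MachinePath V → ℝ :=
    Sum.elim (fun j => (I.vStart j : ℝ)) <| Sum.elim (fun j => -(I.vStart j : ℝ)) <|
    Sum.elim (fun j => (I.vEnd j : ℝ)) <| Sum.elim (fun _ => 1) <|
    Sum.elim (fun _ => -1) <| Sum.elim (fun q => -(q.rhs : ℝ)) <| fun _ => 0
  have hmem : ∀ x : MachinePath V → ℝ, (∀ i ∈ s, β i ≤ g i x) ↔
      (∀ j ∈ I.depots, (I.vStart j : ℝ) ≤ rowForm P (start j) x) ∧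
      (∀ j ∈ I.depots, rowForm P (start j) x ≤ (I.vStart j : ℝ)) ∧
      (∀ j ∈ I.depots, (I.vEnd j : ℝ) ≤ rowForm P (finish j) x) ∧
      (∀ i ∈ I.tasks, 1 ≤ rowForm P (serve i) x) ∧
      (∀ i ∈ I.tasks, rowForm P (serve i) x ≤ 1) ∧
      (∀ q ∈ Ω, rowForm P (cut q) x ≤ q.rhs) ∧ ∀ p ∈ P, 0 ≤ x p := by
    intro x
    simp [s, g, β, Sum.forall]
  have hle : ∃ x, ∀ i ∈ s, β i ≤ g i x := by
    obtain ⟨z, hz⟩ := hfeas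
    have hsupp : z.support ⊆ P := fun p hp => hz.support p hp
    refine ⟨z, (hmem _).2 ?_⟩
    simp only [rowForm_eq_sum _ hsupp]
    exact ⟨fun j hj => (hz.start j hj).ge, fun j hj => (hz.start j hj).le, hz.finish,
      fun i hi => (hz.serve i hi).ge, fun i hi => (hz.serve i hi).le, hz.cuts,
      fun p _ => hz.nonneg p⟩
  have hbdd : ∀ x, (∀ i ∈ s, β i ≤ g i x) → 0 ≤ rowForm P I.pathCost x := by
    intro x hx
    rw [rowForm_apply]
    exact Finset.sum_nonneg fun p hp =>
      mul_nonneg (hcost p hp) (((hmem x).1 hx).2.2.2.2.2.2 p hp)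
  obtain ⟨x, hx, u, hu, hc, hval⟩ :=
    exists_optimal_and_certificate s g β (rowForm P I.pathCost) 0 hle hbdd
  obtain ⟨h1, h2, h3, h4, h5, h6, h7⟩ := (hmem x).1 hx
  -- The constraints say nothing about `x` outside `P`, so it is cut off there.
  let z : MachinePath V →₀ ℝ := Finsupp.onFinset P (fun p => if p ∈ P then x p else 0)
    (fun p hp => by by_contra h; simp [h] at hp)
  have hzsupp : z.support ⊆ P := Finsupp.support_onFinset_subset
  have hrow : ∀ a, z.sum (fun p x => a p * x) = rowForm P a x := by
    intro a
    rw [← rowForm_eq_sum a hzsupp, rowForm_apply, rowForm_apply]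
    exact Finset.sum_congr rfl fun p hp => by simp [z, hp]
  -- The two multipliers of an equality combine to a variable of free sign; the negation of the cuts
  -- makes `lam` nonpositive.
  let y : I.Dual :=
    { κ := fun j => u (.inl j) - u (.inr (.inl j))
      μ := fun j => u (.inr (.inr (.inl j)))
      ν := fun i => u (.inr (.inr (.inr (.inl i)))) - u (.inr (.inr (.inr (.inr (.inl i)))))
      lam := fun q => -u (.inr (.inr (.inr (.inr (.inr (.inl q)))))) }
  refine ⟨z, y, ⟨fun p hp => hzsupp hp, ?_, ?_, ?_, ?_, ?_⟩, ⟨?_, ?_, ?_⟩, ?_⟩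
  · intro p
    by_cases hp : p ∈ P
    · simpa [z, hp] using h7 p hp
    · simp [z, hp]
  · exact fun j hj => (hrow (start j)).trans (le_antisymm (h2 j hj) (h1 j hj))
  · exact fun j hj => (h3 j hj).trans_eq (hrow (finish j)).symm
  · exact fun i hi => (hrow (serve i)).trans (le_antisymm (h5 i hi) (h4 i hi))
  · exact fun q hq => (hrow (cut q)).trans_le (h6 q hq)
  · exact fun j hj => hu _ (by simp [s, hj])
  · exact fun q hq => neg_nonpos.2 (hu _ (by simpa [s] using hq))
  · intro p hp
    -- Tested on the unit vector of `p`, the certificate identifies the reduced cost of `p` with the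
    -- multiplier of `0 ≤ x p`.
    have h := hc (Pi.single p 1)
    have hp0 : 0 ≤ u (.inr (.inr (.inr (.inr (.inr (.inr p)))))) := hu _ (by simpa [s] using hp)
    have hsingle : ∑ p' ∈ P, u (.inr (.inr (.inr (.inr (.inr (.inr p')))))) *
        (Pi.single p 1 : MachinePath V → ℝ) p'
          = u (.inr (.inr (.inr (.inr (.inr (.inr p)))))) := by
      simp [Pi.single_apply, hp]
    simp only [s, g, Finset.sum_disjSum, Sum.elim_inl, Sum.elim_inr, LinearMap.neg_apply,
      rowForm_single _ hp, LinearMap.proj_apply, hsingle, mul_neg, Finset.sum_neg_distrib] at h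
    have e : I.reducedCost Ω y p = u (.inr (.inr (.inr (.inr (.inr (.inr p)))))) := by
      simp only [Instance.reducedCost, y, mul_sub, Finset.sum_sub_distrib, neg_mul,
        Finset.sum_neg_distrib]
      simp only [start, finish, serve, cut] at h
      rw [h]
      simp only [mul_comm (u _)]
      ring
    rw [e]
    exact hp0
  · rw [show I.objective z = rowForm P I.pathCost x from hrow _, ← hval]
    simp only [s, β, y, Instance.dualObjective, Finset.sum_disjSum, Sum.elim_inl, Sum.elim_inr,
      mul_sub, mul_neg, Finset.sum_sub_distrib, Finset.sum_neg_distrib, mul_zero, mul_one,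
      Finset.sum_const_zero]
    simp only [mul_comm (u _)]
    ring

/-- By weak duality, feasible solutions of equal value are both optimal. This makes Step 1
executable. -/
theorem Instance.exists_primalOptimal_dualOptimal (I : Instance V) {P : Finset (MachinePath V)}
    {Ω : Finset I.Cut} (hcost : ∀ p ∈ P, 0 ≤ I.pathCost p)
    (hfeas : ∃ z, I.RelaxFeasible (P : Set (MachinePath V)) (Ω : Set I.Cut) z) :
    ∃ z y, I.PrimalOptimal P Ω z ∧ I.DualOptimal P Ω y := by
  obtain ⟨z, y, hz, hy, h⟩ := I.exists_primal_dual hcost hfeas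
  exact ⟨z, y, ⟨hz, fun z' hz' => h ▸ I.dualObjective_le_objective hz' hy.1 hy.2 hy.3⟩,
    hy, fun y' hy' => h ▸ I.dualObjective_le_objective hz hy'.1 hy'.2 hy'.3⟩

/-- **Strong duality** for the restricted master problem. -/
theorem Instance.objective_eq_dualObjective (I : Instance V) {P : Finset (MachinePath V)}
    {Ω : Finset I.Cut} (hcost : ∀ p ∈ P, 0 ≤ I.pathCost p) {z : MachinePath V →₀ ℝ} {y : I.Dual}
    (hz : I.PrimalOptimal P Ω z) (hy : I.DualOptimal P Ω y) :
    I.objective z = I.dualObjective Ω y := by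
  obtain ⟨z', y', hz', hy', h⟩ := I.exists_primal_dual hcost ⟨z, hz.1⟩
  refine le_antisymm ?_ (I.dualObjective_le_objective hz.1 hy.1.1 hy.1.2 hy.1.3)
  calc I.objective z ≤ I.objective z' := hz.2 z' hz'
    _ = I.dualObjective Ω y' := h.symm
    _ ≤ I.dualObjective Ω y := hy.2 y' hy'

/-! ### Finitely many node sequences -/

theorem Instance.finite_nodes (I : Instance V) : Finite V := by
  refine Set.finite_univ_iff.1 ((I.depots ∪ I.tasks ∪ I.chargers).finite_toSet.subset ?_)
  intro v _
  have := I.cover v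
  simp only [Finset.coe_union, Set.mem_union, Finset.mem_coe]
  tauto

/-- There are finitely many arcs. The uniform bound turns the horizon into a bound on the number of
nodes of a path. -/
theorem Instance.exists_time_lower_bound (I : Instance V) :
    ∃ ε : ℝ, 0 < ε ∧ ∀ i j, I.arc i j → ε ≤ I.time i j := by
  have := I.finite_nodes
  have hfin : {ij : V × V | I.arc ij.1 ij.2}.Finite := Set.toFinite _
  rcases {ij : V × V | I.arc ij.1 ij.2}.eq_empty_or_nonempty with h | h
  · refine ⟨1, one_pos, fun i j hij => ?_⟩
    have : (i, j) ∈ {ij : V × V | I.arc ij.1 ij.2} := hij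
    simp [h] at this
  · obtain ⟨⟨i, j⟩, hij, hmin⟩ :=
      hfin.exists_minimalFor (fun ij : V × V => I.time ij.1 ij.2) _ h
    refine ⟨I.time i j, I.time_pos i j hij, fun i' j' h' => ?_⟩
    rcases le_total (I.time i j) (I.time i' j') with h | h
    · exact h
    · exact hmin (j := (i', j')) h' h

theorem Instance.mul_le_arrivalTime (I : Instance V) {ε : ℝ}
    (hε : ∀ i j, I.arc i j → ε ≤ I.time i j) {p : MachinePath V} (hp : I.IsPath p) :
    ∀ k ≤ p.seq.len, (k : ℝ) * ε ≤ I.arrivalTime p k := by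
  intro k
  induction k with
  | zero => simp [Instance.arrivalTime]
  | succ k ih =>
    intro hk
    have h1 := ih (by omega)
    have h2 := hε _ _ (hp.arcs k (by omega))
    rw [Instance.arrivalTime]
    push_cast
    split_ifs with hc
    · have := hp.τ_nonneg k (by omega) hc
      linarith
    · linarith

theorem Instance.arrivalTime_nonneg (I : Instance V) {p : MachinePath V} (hp : I.IsPath p)
    {k : ℕ} (hk : k ≤ p.seq.len) : 0 ≤ I.arrivalTime p k := by
  simpa using I.mul_le_arrivalTime (ε := 0) (fun i j h => (I.time_pos i j h).le) hp k hk

theorem NodeSeq.ext_of_le {U U' : NodeSeq V} (hlen : U.len = U'.len)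
    (h : ∀ k ≤ U.len, U.node k = U'.node k) : U = U' := by
  obtain ⟨n, f, hf⟩ := U
  obtain ⟨n', f', hf'⟩ := U'
  obtain rfl : n = n' := hlen
  obtain rfl : f = f' := by
    funext k
    rcases le_or_gt k n with hk | hk
    · exact h k hk
    · rw [hf k hk, hf' k hk]
      exact h n le_rfl
  rfl

/-- Thanks to the padding, a sequence is determined by its length and its first `L + 1` nodes. -/
theorem finite_nodeSeq_len_le [Finite V] (L : ℕ) : {U : NodeSeq V | U.len ≤ L}.Finite := by
  let f : NodeSeq V → ℕ × (Fin (L + 1) → V) := fun U => (U.len, fun k => U.node k)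
  have hmaps : Set.MapsTo f {U | U.len ≤ L} (Set.Iic L ×ˢ Set.univ) := fun U hU => ⟨hU, trivial⟩
  refine Set.Finite.of_injOn hmaps ?_ ((Set.finite_Iic L).prod Set.finite_univ)
  intro U hU U' hU' h
  have h1 : U.len = U'.len := congrArg Prod.fst h
  refine NodeSeq.ext_of_le h1 fun k hk => ?_
  have hU : U.len ≤ L := hU
  exact congrFun (congrArg Prod.snd h) ⟨k, by omega⟩

/-- Feasible paths have only finitely many node sequences. -/
theorem Instance.finite_feasible_seq (I : Instance V) :
    {U : NodeSeq V | ∃ p ∈ I.feasiblePaths, p.seq = U}.Finite := by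
  have := I.finite_nodes
  obtain ⟨ε, hε, hle⟩ := I.exists_time_lower_bound
  refine (finite_nodeSeq_len_le ⌊I.horizon / ε⌋₊).subset ?_
  rintro _ ⟨p, hp, rfl⟩
  have h1 := I.mul_le_arrivalTime hle hp.1 p.seq.len le_rfl
  have h2 := (hp.2 p.seq.len hp.1.one_le_len le_rfl).1.2
  exact Nat.le_floor ((le_div_iff₀ hε).2 (h1.trans h2))

theorem Instance.pathCost_nonneg (I : Instance V) {p : MachinePath V} (hp : I.IsPath p) :
    0 ≤ I.pathCost p := by
  refine Finset.sum_nonneg fun k hk => ?_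
  have hk := Finset.mem_range.1 hk
  have h1 := I.cost_pos _ _ (hp.arcs k hk)
  split_ifs with hc
  · have := mul_nonneg (I.chargeCost_pos _ hc).le (hp.τ_nonneg k hk hc)
    linarith
  · linarith

/-! ### Optimal charging times by compactness -/

theorem Instance.continuous_arrivalTime (I : Instance V) (U : NodeSeq V) (k : ℕ) :
    Continuous fun τ : ℕ → ℝ => I.arrivalTime ⟨U, τ⟩ k := by
  induction k with
  | zero => exact continuous_const
  | succ k ih =>
    simp only [Instance.arrivalTime]
    split_ifs
    · fun_prop
    · fun_prop

/-- The cap at the battery capacity makes the charge non-affine in the charging times, but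
continuity is all that compactness needs. -/
theorem Instance.continuous_arrivalCharge (I : Instance V) (U : NodeSeq V) (k : ℕ) :
    Continuous fun τ : ℕ → ℝ => I.arrivalCharge ⟨U, τ⟩ k := by
  induction k with
  | zero => exact continuous_const
  | succ k ih =>
    simp only [Instance.arrivalCharge]
    split_ifs
    · fun_prop
    · fun_prop

theorem Instance.continuous_pathCost (I : Instance V) (U : NodeSeq V) :
    Continuous fun τ : ℕ → ℝ => I.pathCost ⟨U, τ⟩ := by
  simp only [Instance.pathCost]
  refine continuous_finsetSum _ fun k _ => ?_
  split_ifs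
  · fun_prop
  · fun_prop

/-- Charging at node `k` ends before node `k + 1` is reached, hence within the horizon. -/
theorem Instance.τ_mem_Icc (I : Instance V) {p : MachinePath V} (hp : p ∈ I.feasiblePaths)
    (k : ℕ) : p.τ k ∈ Set.Icc 0 I.horizon := by
  by_cases h : k < p.seq.len ∧ p.seq.node k ∈ I.chargers
  · refine ⟨hp.1.τ_nonneg k h.1 h.2, ?_⟩
    have h1 := (hp.2 (k + 1) (by omega) h.1).1.2
    rw [Instance.arrivalTime, if_pos h.2] at h1
    have h2 := I.arrivalTime_nonneg hp.1 h.1.le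
    have h3 := I.time_pos _ _ (hp.1.arcs k h.1)
    linarith
  · rw [hp.1.τ_zero k h]
    have := (hp.2 1 le_rfl hp.1.one_le_len).1
    exact ⟨le_rfl, this.1.trans this.2⟩

/-- The feasible charging times of a node sequence form a compact set. -/
theorem Instance.isCompact_feasible_τ (I : Instance V) (U : NodeSeq V) :
    IsCompact {τ : ℕ → ℝ | (⟨U, τ⟩ : MachinePath V) ∈ I.feasiblePaths} := by
  -- Tychonoff: the box is compact in the product topology, although `τ` has infinitely many
  -- coordinates.
  have hbox := isCompact_univ_pi fun _ : ℕ => isCompact_Icc (a := (0 : ℝ)) (b := I.horizon)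
  refine hbox.of_isClosed_subset ?_ (fun τ hτ k _ => I.τ_mem_Icc hτ k)
  -- These conditions do not involve `τ`. If they fail the set is empty; otherwise only closed
  -- conditions on `τ` remain.
  by_cases hU : 1 ≤ U.len ∧ (∀ k < U.len, I.arc (U.node k) (U.node (k + 1))) ∧
      U.node 0 ∈ I.depots ∧ U.node U.len ∈ I.depots ∧
      ∀ k, 0 < k → k < U.len → U.node k ∈ I.tasks ∨ U.node k ∈ I.chargers
  · obtain ⟨h1, h2, h3, h4, h5⟩ := hU
    have heq : {τ : ℕ → ℝ | (⟨U, τ⟩ : MachinePath V) ∈ I.feasiblePaths} =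
        {τ | (∀ k, k < U.len → U.node k ∈ I.chargers → 0 ≤ τ k) ∧
          (∀ k, ¬ (k < U.len ∧ U.node k ∈ I.chargers) → τ k = 0) ∧
          ∀ k, 1 ≤ k → k ≤ U.len → I.arrivalTime ⟨U, τ⟩ k ∈ Set.Icc 0 I.horizon ∧
            I.arrivalCharge ⟨U, τ⟩ k ∈ Set.Icc 0 I.capacity} := by
      ext τ
      exact ⟨fun h => ⟨h.1.τ_nonneg, h.1.τ_zero, h.2⟩,
        fun h => ⟨⟨h1, h2, h3, h4, h5, h.1, h.2.1⟩, h.2.2⟩⟩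
    rw [heq]
    simp only [Set.ofPred_and, Set.ofPred_forall]
    refine IsClosed.inter ?_ (IsClosed.inter ?_ ?_)
    · exact isClosed_iInter fun k => isClosed_iInter fun _ => isClosed_iInter fun _ =>
        isClosed_le continuous_const (continuous_apply k)
    · exact isClosed_iInter fun k => isClosed_iInter fun _ =>
        isClosed_eq (continuous_apply k) continuous_const
    · exact isClosed_iInter fun k => isClosed_iInter fun _ => isClosed_iInter fun _ =>
        (isClosed_Icc.preimage (I.continuous_arrivalTime U k)).inter
          (isClosed_Icc.preimage (I.continuous_arrivalCharge U k))
  · have heq : {τ : ℕ → ℝ | (⟨U, τ⟩ : MachinePath V) ∈ I.feasiblePaths} = ∅ := by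
      refine Set.eq_empty_iff_forall_notMem.2 fun τ h => hU ?_
      exact ⟨h.1.one_le_len, h.1.arcs, h.1.first, h.1.last, h.1.middle⟩
    rw [heq]
    exact isClosed_empty

/-- Charging times can be optimized: every feasible path can be replaced by a minimal one with the
same node sequence. -/
theorem Instance.exists_isMinimalPath (I : Instance V) {p : MachinePath V}
    (hp : p ∈ I.feasiblePaths) :
    ∃ p', I.IsMinimalPath p' ∧ p'.seq = p.seq ∧ I.pathCost p' ≤ I.pathCost p := by
  obtain ⟨τ, hτ, hmin⟩ := (I.isCompact_feasible_τ p.seq).exists_isMinOn ⟨p.τ, hp⟩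
    (I.continuous_pathCost p.seq).continuousOn
  refine ⟨⟨p.seq, τ⟩, ⟨hτ, ?_⟩, rfl, hmin hp⟩
  rintro ⟨U, τ'⟩ hp' (rfl : U = p.seq)
  exact hmin hp'

/-- All terms of the reduced cost other than the path cost depend on the node sequence alone. -/
theorem Instance.reducedCost_sub (I : Instance V) (Ω : Finset I.Cut) (y : I.Dual)
    {p p' : MachinePath V} (h : p'.seq = p.seq) :
    I.reducedCost Ω y p' - I.reducedCost Ω y p = I.pathCost p' - I.pathCost p := by
  simp only [Instance.reducedCost, h]
  ring

/-! ### Elementary paths and ng-neighborhoods -/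

theorem NodeSeq.two_le_visits {U : NodeSeq V} {i : V} {j k : ℕ} (hjk : j < k) (hk : k ≤ U.len)
    (hj : U.node j = i) (hki : U.node k = i) : 2 ≤ U.visits i := by
  have h : ({j, k} : Finset ℕ) ⊆ (Finset.range (U.len + 1)).filter (fun k => U.node k = i) := by
    intro l hl
    simp only [Finset.mem_insert, Finset.mem_singleton] at hl
    simp only [Finset.mem_filter, Finset.mem_range]
    rcases hl with rfl | rfl
    · exact ⟨by omega, hj⟩
    · exact ⟨by omega, hki⟩
  have := Finset.card_le_card h
  rwa [Finset.card_pair hjk.ne] at this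

theorem NodeSeq.exists_of_two_le_visits {U : NodeSeq V} {i : V} (h : 2 ≤ U.visits i) :
    ∃ j k, j < k ∧ k ≤ U.len ∧ U.node j = i ∧ U.node k = i := by
  obtain ⟨a, ha, b, hb, hab⟩ := Finset.one_lt_card.1 h
  simp only [Finset.mem_filter, Finset.mem_range] at ha hb
  rcases lt_or_gt_of_ne hab with hlt | hlt
  · exact ⟨a, b, hlt, by omega, ha.2, hb.2⟩
  · exact ⟨b, a, hlt, by omega, hb.2, ha.2⟩

/-- Elementary paths are ng-feasible for every ng-neighborhood. -/
theorem Instance.elementaryPaths_subset_ngPaths (I : Instance V) {N : V → Set V}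
    (hN : I.IsNgNeighborhood N) : I.elementaryPaths ⊆ I.ngPaths N := by
  rintro p ⟨hp, helem⟩
  refine ⟨hp, fun j k hjk hk heq => ?_⟩
  have htask : p.seq.node j ∉ I.tasks := fun ht => by
    have := helem _ ht
    have := NodeSeq.two_le_visits hjk hk rfl heq.symm
    omega
  -- The repeated node is not a task. The node right after it differs from it, as arcs are not
  -- loops, so it lies strictly inside the cycle; its neighborhood holds only tasks and possibly
  -- itself, so it forgets the repeated node.
  have harc := hp.1.arcs j (by omega)
  have hne : p.seq.node (j + 1) ≠ p.seq.node j := fun h => I.arc_irrefl _ (h ▸ harc)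
  have hk' : j + 1 ≠ k := fun h => hne (h ▸ heq.symm)
  refine ⟨j + 1, by omega, by omega, fun hmem => ?_⟩
  by_cases ht : p.seq.node (j + 1) ∈ I.tasks
  · exact htask (hN.of_task _ ht _ hmem)
  · rcases hN.of_nontask _ ht _ hmem with h | h
    · exact htask h
    · exact hne h.symm

theorem Instance.IsNgNeighborhood.expand {I : Instance V} {N : V → Set V}
    (hN : I.IsNgNeighborhood N) (z : MachinePath V →₀ ℝ) :
    I.IsNgNeighborhood (I.expand N z) where
  self_mem i := Or.inl (hN.self_mem i)
  of_task i hi v hv := hv.elim (hN.of_task i hi v) And.left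
  of_nontask i hi v hv := hv.elim (hN.of_nontask i hi v) fun h => Or.inl h.1

/-- The expansion is proper if `z` uses a non-elementary path. -/
theorem Instance.exists_mem_expand (I : Instance V) {N : V → Set V} {z : MachinePath V →₀ ℝ}
    (hz : ∀ p ∈ z.support, p ∈ I.ngPaths N) (h : ¬ I.UsesElementary z) :
    ∃ v i, i ∉ N v ∧ i ∈ I.expand N z v := by
  simp only [Instance.UsesElementary, Instance.IsElementary] at h
  push Not at h
  obtain ⟨p, hp, i, hi, hvis⟩ := h
  obtain ⟨j, k, hjk, hk, hj, hki⟩ := NodeSeq.exists_of_two_le_visits hvis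
  -- The node that made this cycle ng-feasible is exactly one whose neighborhood now gains `i`.
  obtain ⟨l, hjl, hlk, hl⟩ := (hz p hp).2 j k hjk hk (hj.trans hki.symm)
  exact ⟨p.seq.node l, i, hj ▸ hl, Or.inr ⟨hi, p, hp, j, l, k, hjl, hlk, hk, hj, hki, rfl⟩⟩

/-! ### Coefficients of lm-SRI cuts and their finitely many signatures -/

/-- The maximal blocks of consecutive indices of `U` whose nodes lie in `M`. -/
noncomputable def NodeSeq.blocks (U : NodeSeq V) (M : Finset V) : Finset (ℕ × ℕ) :=
  ((Finset.range (U.len + 1)) ×ˢ (Finset.range (U.len + 1))).filter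
    (fun ab => U.IsBlock M ab.1 ab.2)

theorem NodeSeq.mem_blocks {U : NodeSeq V} {M : Finset V} {ab : ℕ × ℕ} :
    ab ∈ U.blocks M ↔ U.IsBlock M ab.1 ab.2 := by
  simp only [NodeSeq.blocks, Finset.mem_filter, Finset.mem_product, Finset.mem_range]
  refine ⟨fun h => h.2, fun h => ⟨?_, h⟩⟩
  have := h.1
  have := h.2.1
  omega

/-- If one block extended beyond the other, it would contain the index adjacent to the end of the
other, whose node is outside `M` by maximality. -/
theorem NodeSeq.IsBlock.eq_of_mem {U : NodeSeq V} {M : Finset V} {a b a' b' k : ℕ}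
    (h : U.IsBlock M a b) (h' : U.IsBlock M a' b') (hak : a ≤ k) (hkb : k ≤ b) (hak' : a' ≤ k)
    (hkb' : k ≤ b') : a = a' ∧ b = b' := by
  have left : ∀ {a b a' b' : ℕ}, U.IsBlock M a b → U.IsBlock M a' b' → a ≤ k → k ≤ b →
      a' ≤ k → a' ≤ a := by
    intro a b a' b' h h' hak hkb hak'
    by_contra! hlt
    rcases h'.2.2.2.1 with h0 | h0
    · omega
    · exact h0 (h.2.2.1 _ (by omega) (by omega))
  have right : ∀ {a b a' b' : ℕ}, U.IsBlock M a b → U.IsBlock M a' b' → a ≤ k → k ≤ b →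
      k ≤ b' → b ≤ b' := by
    intro a b a' b' h h' hak hkb hkb'
    by_contra! hlt
    have := h.2.1
    rcases h'.2.2.2.2 with h0 | h0
    · omega
    · exact h0 (h.2.2.1 _ (by omega) (by omega))
  exact ⟨le_antisymm (left h' h hak' hkb' hak) (left h h' hak hkb hak'),
    le_antisymm (right h h' hak hkb hkb') (right h' h hak' hkb' hkb)⟩

/-- Grow from `k` in both directions: the least left end and the greatest right end that keep all
nodes in `M`. -/
theorem NodeSeq.exists_isBlock {U : NodeSeq V} {M : Finset V} {k : ℕ} (hk : k ≤ U.len)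
    (hM : U.node k ∈ M) : ∃ a b, U.IsBlock M a b ∧ a ≤ k ∧ k ≤ b := by
  have hex : ∃ a, a ≤ k ∧ ∀ l, a ≤ l → l ≤ k → U.node l ∈ M :=
    ⟨k, le_rfl, fun l h h' => le_antisymm h' h ▸ hM⟩
  obtain ⟨ha, haM⟩ := Nat.find_spec hex
  let Q : ℕ → Prop := fun b => k ≤ b ∧ ∀ l, k ≤ l → l ≤ b → U.node l ∈ M
  have hQk : Q k := ⟨le_rfl, fun l h h' => le_antisymm h' h ▸ hM⟩
  obtain ⟨hb, hbM⟩ : Q (Nat.findGreatest Q U.len) := Nat.findGreatest_spec hk hQk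
  refine ⟨Nat.find hex, Nat.findGreatest Q U.len, ⟨ha.trans hb, Nat.findGreatest_le _, ?_, ?_, ?_⟩,
    ha, hb⟩
  · intro l hl hl'
    rcases le_total l k with h | h
    · exact haM l hl h
    · exact hbM l h hl'
  · rw [or_iff_not_imp_left]
    intro h0 hmem
    refine Nat.find_min hex (m := Nat.find hex - 1) (by omega) ⟨by omega, fun l hl hl' => ?_⟩
    rcases hl.eq_or_lt with rfl | hl
    · exact hmem
    · exact haM l (by omega) hl'
  · rw [or_iff_not_imp_left]
    intro h0 hmem
    have hle : Nat.findGreatest Q U.len ≤ U.len := Nat.findGreatest_le _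
    refine Nat.findGreatest_is_greatest (P := Q) (n := U.len) (Nat.lt_succ_self _) (by omega)
      ⟨by omega, fun l hl hl' => ?_⟩
    rcases hl'.eq_or_lt with rfl | hl'
    · exact hmem
    · exact hbM l hl (by omega)

/-- Every index whose node lies in `M` belongs to exactly one block. -/
theorem NodeSeq.sum_blocks {A : Type*} [AddCommMonoid A] (U : NodeSeq V) (M : Finset V)
    (f : ℕ → A) :
    ∑ ab ∈ U.blocks M, ∑ k ∈ Finset.Icc ab.1 ab.2, f k =
      ∑ k ∈ (Finset.range (U.len + 1)).filter (fun k => U.node k ∈ M), f k := by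
  rw [← Finset.sum_biUnion]
  · refine Finset.sum_congr ?_ fun _ _ => rfl
    ext k
    simp only [Finset.mem_biUnion, Finset.mem_Icc, Finset.mem_filter, Finset.mem_range,
      NodeSeq.mem_blocks, Prod.exists]
    constructor
    · rintro ⟨a, b, h, hak, hkb⟩
      exact ⟨by have := h.2.1; omega, h.2.2.1 k hak hkb⟩
    · rintro ⟨hk, hM⟩
      exact NodeSeq.exists_isBlock (by omega) hM
  · intro ab hab ab' hab' hne
    rw [Function.onFun, Finset.disjoint_left]
    intro k hk hk'
    rw [Finset.mem_Icc] at hk hk'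
    obtain ⟨h1, h2⟩ := (NodeSeq.mem_blocks.1 hab).eq_of_mem (NodeSeq.mem_blocks.1 hab')
      hk.1 hk.2 hk'.1 hk'.2
    exact hne (Prod.ext h1 h2)

/-- As `S ⊆ M`, no visit to `S` falls outside the blocks. The semiring is general because real
weights and their integer floors are both summed. -/
theorem NodeSeq.sum_blocks_visits {A : Type*} [Semiring A] (U : NodeSeq V) {S M : Finset V}
    (hSM : S ⊆ M) (g : V → A) :
    ∑ ab ∈ U.blocks M, ∑ k ∈ Finset.Icc ab.1 ab.2,
      (if U.node k ∈ S then g (U.node k) else 0) = ∑ i ∈ S, g i * U.visits i := by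
  rw [NodeSeq.sum_blocks, Finset.sum_filter]
  have h1 : ∀ k, (if U.node k ∈ M then (if U.node k ∈ S then g (U.node k) else 0) else 0)
      = ∑ i ∈ S, if U.node k = i then g i else 0 := by
    intro k
    rw [Finset.sum_ite_eq]
    by_cases h : U.node k ∈ S
    · simp [h, hSM h]
    · simp [h]
  simp only [h1]
  rw [Finset.sum_comm]
  refine Finset.sum_congr rfl fun i _ => ?_
  rw [← Finset.sum_filter, Finset.sum_const, NodeSeq.visits, nsmul_eq_mul, Nat.cast_comm]

namespace Instance.Cut

variable {I : Instance V} (q : I.Cut)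

theorem coeff_le (U : NodeSeq V) : (q.coeff U : ℝ) ≤ ∑ i ∈ q.S, q.w i * U.visits i := by
  rw [← U.sum_blocks_visits q.S_memory q.w, coeff, Int.cast_sum]
  exact Finset.sum_le_sum fun ab _ => Int.floor_le _

/-- Within a block the floors add up to an integer below the sum of the weights, hence below its
floor. -/
theorem floor_le_coeff (U : NodeSeq V) : ∑ i ∈ q.S, ⌊q.w i⌋ * U.visits i ≤ q.coeff U := by
  rw [← U.sum_blocks_visits q.S_memory (fun i => ⌊q.w i⌋), coeff]
  refine Finset.sum_le_sum fun ab _ => Int.le_floor.2 ?_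
  rw [Int.cast_sum]
  refine Finset.sum_le_sum fun k _ => ?_
  split_ifs
  · exact Int.floor_le _
  · simp

/-- The coefficient of the cut whose weights are the fractional parts of the weights of `q`. -/
noncomputable def fracCoeff (U : NodeSeq V) : ℤ := q.coeff U - ∑ i ∈ q.S, ⌊q.w i⌋ * U.visits i

/-- The right-hand side of the cut whose weights are the fractional parts of the weights of `q`. -/
noncomputable def fracRhs : ℤ := q.rhs - ∑ i ∈ q.S, ⌊q.w i⌋

/-- Each weight exceeds its floor by at most one, so the excess of the coefficient is at most the
number of visits. The point is that the bound does not depend on the cut. -/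
theorem fracCoeff_mem (U : NodeSeq V) :
    q.fracCoeff U ∈ Set.Icc (0 : ℤ) (∑ i ∈ I.tasks, (U.visits i : ℤ)) := by
  refine ⟨sub_nonneg.2 (q.floor_le_coeff U), ?_⟩
  have h1 := q.coeff_le U
  have h2 : (q.coeff U : ℝ) ≤ ∑ i ∈ q.S, (⌊q.w i⌋ : ℝ) * U.visits i
      + ∑ i ∈ q.S, (U.visits i : ℝ) := by
    refine h1.trans ?_
    rw [← Finset.sum_add_distrib]
    refine Finset.sum_le_sum fun i _ => ?_
    have := mul_le_mul_of_nonneg_right (Int.lt_floor_add_one (q.w i)).le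
      (Nat.cast_nonneg (α := ℝ) (U.visits i))
    linarith
  have h3 : q.coeff U ≤ ∑ i ∈ q.S, ⌊q.w i⌋ * U.visits i + ∑ i ∈ q.S, (U.visits i : ℤ) := by
    exact_mod_cast h2
  have h4 : ∑ i ∈ q.S, (U.visits i : ℤ) ≤ ∑ i ∈ I.tasks, (U.visits i : ℤ) :=
    Finset.sum_le_sum_of_subset_of_nonneg q.S_tasks fun _ _ _ => by positivity
  unfold fracCoeff
  linarith

theorem fracRhs_mem : q.fracRhs ∈ Set.Icc (0 : ℤ) I.tasks.card := by
  have h1 : ∑ i ∈ q.S, ⌊q.w i⌋ ≤ q.rhs := by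
    refine Int.le_floor.2 ?_
    rw [Int.cast_sum]
    exact Finset.sum_le_sum fun i _ => Int.floor_le _
  have h2 : (q.rhs : ℝ) ≤ ∑ i ∈ q.S, (⌊q.w i⌋ : ℝ) + q.S.card := by
    refine (Int.floor_le _).trans ?_
    rw [Finset.card_eq_sum_ones, Nat.cast_sum, ← Finset.sum_add_distrib]
    refine Finset.sum_le_sum fun i _ => ?_
    simpa using (Int.lt_floor_add_one (q.w i)).le
  have h3 : q.rhs ≤ ∑ i ∈ q.S, ⌊q.w i⌋ + q.S.card := by exact_mod_cast h2
  have h4 : (q.S.card : ℤ) ≤ I.tasks.card := by exact_mod_cast Finset.card_le_card q.S_tasks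
  unfold fracRhs
  constructor <;> linarith

/-- In the presence of the task constraints, integral parts of the weights do not matter. -/
theorem satisfied_iff_frac {P : Set (MachinePath V)} {Ω : Set I.Cut} {z : MachinePath V →₀ ℝ}
    (hz : I.RelaxFeasible P Ω z) :
    q.Satisfied z ↔ z.sum (fun p x => (q.fracCoeff p.seq : ℝ) * x) ≤ q.fracRhs := by
  have h1 : z.sum (fun p x => (q.fracCoeff p.seq : ℝ) * x)
      = z.sum (fun p x => (q.coeff p.seq : ℝ) * x) - ∑ i ∈ q.S, (⌊q.w i⌋ : ℝ) := by
    have h2 : ∑ i ∈ q.S, (⌊q.w i⌋ : ℝ) = ∑ i ∈ q.S, (⌊q.w i⌋ : ℝ) *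
        z.sum (fun p x => (p.seq.visits i : ℝ) * x) :=
      Finset.sum_congr rfl fun i hi => by rw [hz.serve i (q.S_tasks hi), mul_one]
    rw [h2]
    simp only [Finsupp.sum, Finset.mul_sum]
    rw [Finset.sum_comm, ← Finset.sum_sub_distrib]
    refine Finset.sum_congr rfl fun p _ => ?_
    simp only [fracCoeff, Int.cast_sub, Int.cast_sum, Int.cast_mul, Int.cast_natCast, sub_mul,
      Finset.sum_mul, mul_assoc]
  rw [h1, Satisfied, fracRhs, Int.cast_sub, Int.cast_sum]
  exact (sub_le_sub_iff_right _).symm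

/-- The data of a cut that matter for solutions over feasible paths. -/
noncomputable def signature :
    ({U : NodeSeq V | ∃ p ∈ I.feasiblePaths, p.seq = U} → ℤ) × ℤ :=
  (fun U => q.fracCoeff U, q.fracRhs)

theorem finite_range_signature (I : Instance V) :
    (Set.range fun q : I.Cut => q.signature).Finite := by
  have := I.finite_feasible_seq.to_subtype
  refine ((Set.Finite.pi' fun U : {U : NodeSeq V | ∃ p ∈ I.feasiblePaths, p.seq = U} =>
    Set.finite_Icc (0 : ℤ) (∑ i ∈ I.tasks, ((U : NodeSeq V).visits i : ℤ))).prod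
    (Set.finite_Icc (0 : ℤ) I.tasks.card)).subset ?_
  rintro _ ⟨q, rfl⟩
  exact ⟨fun U => q.fracCoeff_mem U, q.fracRhs_mem⟩

variable {q}

/-- Contrapositively, a cut violated by `z` has a signature different from those of all cuts that
`z` satisfies. -/
theorem Satisfied.of_signature_eq {q' : I.Cut} {P : Set (MachinePath V)} {Ω : Set I.Cut}
    {z : MachinePath V →₀ ℝ} (hP : P ⊆ I.feasiblePaths) (hz : I.RelaxFeasible P Ω z)
    (hq : q.Satisfied z) (h : q.signature = q'.signature) : q'.Satisfied z := by
  rw [satisfied_iff_frac _ hz] at hq ⊢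
  have h1 : q.fracRhs = q'.fracRhs := congrArg Prod.snd h
  rw [← h1]
  refine le_of_eq_of_le (Finset.sum_congr rfl fun p hp => ?_) hq
  have h2 : q.fracCoeff p.seq = q'.fracCoeff p.seq :=
    congrFun (congrArg Prod.fst h) ⟨p.seq, p, hP (hz.support p hp), rfl⟩
  simp only [h2]

end Instance.Cut

/-! ### Integer solutions: validity of the cuts and elementarity -/

/-- lm-SRI cuts are valid for the integer problem. -/
theorem Instance.IntFeasible.satisfied {I : Instance V} {P : Set (MachinePath V)}
    {z : MachinePath V →₀ ℝ} (hz : I.IntFeasible P z) (q : I.Cut) : q.Satisfied z := by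
  choose n hn using hz.2
  have h1 : z.sum (fun p x => (q.coeff p.seq : ℝ) * x)
      = ((∑ p ∈ z.support, q.coeff p.seq * (n p : ℤ) : ℤ) : ℝ) := by
    rw [Finsupp.sum]
    push_cast
    exact Finset.sum_congr rfl fun p _ => by rw [hn]
  -- Chvátal-Gomory rounding: the left-hand side is an integer, so it suffices to bound it by the
  -- unrounded sum of the weights.
  rw [Instance.Cut.Satisfied, h1, Int.cast_le, Instance.Cut.rhs, Int.le_floor, ← h1]
  have h2 : ∑ i ∈ q.S, q.w i = ∑ i ∈ q.S, q.w i *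
      z.sum (fun p x => (p.seq.visits i : ℝ) * x) :=
    Finset.sum_congr rfl fun i hi => by rw [hz.1.serve i (q.S_tasks hi), mul_one]
  rw [h2]
  simp only [Finsupp.sum, Finset.mul_sum]
  rw [Finset.sum_comm]
  refine Finset.sum_le_sum fun p _ => ?_
  have := mul_le_mul_of_nonneg_right (q.coeff_le p.seq) (hz.1.nonneg p)
  simpa only [Finset.sum_mul, mul_assoc] using this

/-- Integer solutions use elementary paths only. -/
theorem Instance.IntFeasible.usesElementary {I : Instance V} {P : Set (MachinePath V)}
    {z : MachinePath V →₀ ℝ} (hz : I.IntFeasible P z) : I.UsesElementary z := by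
  intro p hp i hi
  obtain ⟨n, hn⟩ := hz.2 p
  have hn0 : n ≠ 0 := by
    rintro rfl
    exact Finsupp.mem_support_iff.1 hp (by simpa using hn)
  have h1 : (p.seq.visits i : ℝ) * z p ≤ 1 := by
    rw [← hz.1.serve i hi, Finsupp.sum]
    exact Finset.single_le_sum (f := fun p => (p.seq.visits i : ℝ) * z p)
      (fun p _ => mul_nonneg (Nat.cast_nonneg _) (hz.1.nonneg p)) hp
  rw [hn] at h1
  have h2 : p.seq.visits i * n ≤ 1 := by exact_mod_cast h1
  exact (Nat.le_mul_of_pos_right _ (Nat.pos_of_ne_zero hn0)).trans h2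

/-! ### The invariant, and why no run gets stuck -/

variable {I : Instance V} {C : Set I.Cut}

/-- What holds throughout column generation, for an integer solution `zInt` over the initial
paths: its paths are never deleted. -/
structure GeneratingInvariant (C : Set I.Cut) (zInt : MachinePath V →₀ ℝ) (N : V → Set V)
    (Ω : Finset I.Cut) (P : Finset (MachinePath V)) : Prop where
  ng : I.IsNgNeighborhood N
  cuts : ∀ q ∈ Ω, q ∈ C
  paths : ∀ p ∈ P, p ∈ I.ngPaths N
  int : I.IntFeasible (P : Set (MachinePath V)) zInt

/-- What holds at the end of column generation, for its solution `z`. -/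
structure OptimizedInvariant (C : Set I.Cut) (zInt : MachinePath V →₀ ℝ) (N : V → Set V)
    (Ω : Finset I.Cut) (P : Finset (MachinePath V)) (z : MachinePath V →₀ ℝ) : Prop
    extends GeneratingInvariant C zInt N Ω P where
  primal : I.PrimalOptimal P Ω z
  dual : ∃ y, I.DualOptimal P Ω y ∧ ∀ p ∈ I.ngPaths N, 0 ≤ I.reducedCost Ω y p

/-- The invariant of the algorithm. -/
def Invariant (C : Set I.Cut) (zInt : MachinePath V →₀ ℝ) : I.State → Prop
  | .generating N Ω P => GeneratingInvariant C zInt N Ω P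
  | .optimized N Ω P z => OptimizedInvariant C zInt N Ω P z
  | .returned z => (∃ N Ω P, OptimizedInvariant C zInt N Ω P z) ∧ I.UsesElementary z ∧
      ∀ q ∈ C, q.Satisfied z

theorem Instance.RelaxFeasible.mono {P Q : Set (MachinePath V)} {Ω Ω' : Set I.Cut}
    {z : MachinePath V →₀ ℝ} (hz : I.RelaxFeasible P Ω z) (hP : ∀ p ∈ z.support, p ∈ Q)
    (hΩ : ∀ q ∈ Ω', q.Satisfied z) : I.RelaxFeasible Q Ω' z :=
  ⟨hP, hz.nonneg, hz.start, hz.finish, hz.serve, hΩ⟩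

theorem GeneratingInvariant.relaxFeasible {zInt : MachinePath V →₀ ℝ} {N : V → Set V}
    {Ω : Finset I.Cut} {P : Finset (MachinePath V)} (h : GeneratingInvariant C zInt N Ω P) :
    I.RelaxFeasible (P : Set (MachinePath V)) (Ω : Set I.Cut) zInt :=
  h.int.1.mono h.int.1.support fun q _ => h.int.satisfied q

theorem GeneratingInvariant.pathCost_nonneg {zInt : MachinePath V →₀ ℝ} {N : V → Set V}
    {Ω : Finset I.Cut} {P : Finset (MachinePath V)} (h : GeneratingInvariant C zInt N Ω P) :
    ∀ p ∈ P, 0 ≤ I.pathCost p :=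
  fun p hp => I.pathCost_nonneg (h.paths p hp).1.1

theorem Invariant.step {zInt : MachinePath V →₀ ℝ} {s s' : I.State} (h : Invariant C zInt s)
    (hstep : I.Step C s s') : Invariant C zInt s' := by
  cases hstep with
  | price N Ω P Pnew y hy hne hnew =>
    refine ⟨h.ng, h.cuts, ?_, h.int.1.mono ?_ (by simp), h.int.2⟩
    · intro p hp
      rcases Finset.mem_union.1 hp with hp | hp
      · exact h.paths p hp
      · exact (hnew p hp).1
    · intro p hp
      exact Finset.mem_coe.2 (Finset.mem_union_left _ (h.int.1.support p hp))
  | optimal N Ω P y z hy hz hnone => exact ⟨h, hz, y, hy, hnone⟩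
  | terminate N Ω P z helem hcuts => exact ⟨⟨N, Ω, P, h⟩, helem, hcuts⟩
  | elementarity N Ω P z helem =>
    refine ⟨h.ng.expand z, h.cuts, fun p hp => (Finset.mem_filter.1 hp).2,
      h.int.1.mono ?_ (by simp), h.int.2⟩
    -- Paths of an integer solution are elementary, hence ng-feasible for the expanded neighborhoods
    -- too: the filter keeps them.
    intro p hp
    have hpP : p ∈ P := h.int.1.support p hp
    exact Finset.mem_coe.2 (Finset.mem_filter.2 ⟨hpP, I.elementaryPaths_subset_ngPaths
      (h.ng.expand z) ⟨(h.paths p hpP).1, h.int.usesElementary p hp⟩⟩)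
  | integrality N Ω P z q helem hq hviol =>
    refine ⟨h.ng, fun q' hq' => ?_, h.paths, h.int⟩
    rcases Finset.mem_insert.1 hq' with rfl | hq'
    · exact hq
    · exact h.cuts q' hq'

theorem Invariant.reaches {zInt : MachinePath V →₀ ℝ} {s s' : I.State} (h : Invariant C zInt s)
    (hs : I.Reaches C s s') : Invariant C zInt s' := by
  induction hs with
  | refl => exact h
  | tail _ hstep ih => exact ih.step hstep

theorem Invariant.exists_step {zInt : MachinePath V →₀ ℝ} {s : I.State}
    (h : Invariant C zInt s) : (∃ z, s = .returned z) ∨ ∃ s', I.Step C s s' := by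
  cases s with
  | returned z => exact Or.inl ⟨z, rfl⟩
  | optimized N Ω P z =>
    right
    by_cases helem : I.UsesElementary z
    · by_cases hcuts : ∀ q ∈ C, q.Satisfied z
      · exact ⟨_, .terminate N Ω P z helem hcuts⟩
      · push Not at hcuts
        obtain ⟨q, hq, hviol⟩ := hcuts
        exact ⟨_, .integrality N Ω P z q helem hq hviol⟩
    · exact ⟨_, .elementarity N Ω P z helem⟩
  | generating N Ω P =>
    right
    have h : GeneratingInvariant C zInt N Ω P := h
    obtain ⟨z, y, hz, hy⟩ := I.exists_primalOptimal_dualOptimal h.pathCost_nonneg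
      ⟨zInt, h.relaxFeasible⟩
    by_cases hnone : ∀ p ∈ I.ngPaths N, 0 ≤ I.reducedCost Ω y p
    · exact ⟨_, .optimal N Ω P y z hy hz hnone⟩
    · push Not at hnone
      obtain ⟨p, hp, hneg⟩ := hnone
      -- Pricing requires a minimal path. Optimizing the charging times of `p` preserves
      -- ng-feasibility and cannot raise the reduced cost.
      obtain ⟨p', hmin, hseq, hle⟩ := I.exists_isMinimalPath hp.1
      refine ⟨_, .price N Ω P {p'} y hy (Finset.singleton_nonempty _) fun p'' hp'' => ?_⟩
      rw [Finset.mem_singleton] at hp''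
      subst hp''
      refine ⟨⟨hmin.1, ?_⟩, hmin, ?_⟩
      · rw [hseq]
        exact hp.2
      · have := I.reducedCost_sub Ω y hseq
        linarith

/-! ### Termination -/

/-- The pairs that can still be added to the ng-neighborhoods. -/
def missingPairs (N : V → Set V) : Set (V × V) := {vi | vi.2 ∉ N vi.1}

/-- The signatures of cuts that have not been added. -/
def missingSignatures (Ω : Finset I.Cut) :
    Set (({U : NodeSeq V | ∃ p ∈ I.feasiblePaths, p.seq = U} → ℤ) × ℤ) :=
  {σ | (∃ q : I.Cut, q.signature = σ) ∧ ¬ ∃ q ∈ Ω, q.signature = σ}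

/-- The node sequences of feasible paths without a minimal path among `P`. -/
def missingSeqs (I : Instance V) (P : Finset (MachinePath V)) : Set (NodeSeq V) :=
  {U | (∃ p ∈ I.feasiblePaths, p.seq = U) ∧ ¬ ∃ p ∈ P, I.IsMinimalPath p ∧ p.seq = U}

/-- A lexicographic measure of progress. -/
noncomputable def progress : I.State → ℕ ×ₗ ℕ ×ₗ ℕ ×ₗ ℕ
  | .generating N Ω P => toLex ((missingPairs N).ncard, toLex ((missingSignatures Ω).ncard,
      toLex ((missingSeqs I P).ncard, 1)))
  | .optimized N Ω P _ => toLex ((missingPairs N).ncard, toLex ((missingSignatures Ω).ncard,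
      toLex ((missingSeqs I P).ncard, 0)))
  | .returned _ => toLex (0, toLex (0, toLex (0, 0)))

theorem ncard_missingPairs_expand_lt {N : V → Set V} {z : MachinePath V →₀ ℝ}
    (hz : ∀ p ∈ z.support, p ∈ I.ngPaths N) (h : ¬ I.UsesElementary z) :
    (missingPairs (I.expand N z)).ncard < (missingPairs N).ncard := by
  have := I.finite_nodes
  obtain ⟨v, i, hN, hexp⟩ := I.exists_mem_expand hz h
  refine Set.ncard_lt_ncard ⟨fun vi hvi h => hvi (Or.inl h), fun hsub => ?_⟩ (Set.toFinite _)
  exact hsub (show (v, i) ∈ missingPairs N from hN) hexp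

/-- `z` satisfies every cut in `Ω`, so none of them shares its signature with the violated cut `q`.
-/
theorem ncard_missingSignatures_insert_lt {P : Set (MachinePath V)} {Ω : Finset I.Cut}
    {z : MachinePath V →₀ ℝ} (hP : P ⊆ I.feasiblePaths)
    (hz : I.RelaxFeasible P (Ω : Set I.Cut) z) {q : I.Cut} (hviol : ¬ q.Satisfied z) :
    (missingSignatures (insert q Ω)).ncard < (missingSignatures Ω).ncard := by
  refine Set.ncard_lt_ncard ⟨fun σ hσ => ⟨hσ.1, ?_⟩, fun hsub => ?_⟩
    ((Instance.Cut.finite_range_signature I).subset fun σ hσ => hσ.1)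
  · rintro ⟨q', hq', h⟩
    exact hσ.2 ⟨q', Finset.mem_insert_of_mem hq', h⟩
  · have hmem : q.signature ∈ missingSignatures Ω := by
      refine ⟨⟨q, rfl⟩, ?_⟩
      rintro ⟨q', hq', h⟩
      exact hviol ((hz.cuts q' hq').of_signature_eq hP hz h)
    exact (hsub hmem).2 ⟨q, Finset.mem_insert_self _ _, rfl⟩

/-- A minimal path in `P` with the sequence of a new path would have the same cost, hence negative
reduced cost, against dual feasibility. Only minimal paths are counted because the initial paths
need not be minimal. -/
theorem ncard_missingSeqs_union_lt {P Pnew : Finset (MachinePath V)} {Ω : Finset I.Cut}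
    {y : I.Dual} (hy : I.DualFeasible P Ω y) (hne : Pnew.Nonempty)
    (hnew : ∀ p ∈ Pnew, I.IsMinimalPath p ∧ I.reducedCost Ω y p < 0) :
    (missingSeqs I (P ∪ Pnew)).ncard < (missingSeqs I P).ncard := by
  refine Set.ncard_lt_ncard ⟨fun U hU => ⟨hU.1, ?_⟩, fun hsub => ?_⟩
    (I.finite_feasible_seq.subset fun U hU => hU.1)
  · rintro ⟨p, hp, h⟩
    exact hU.2 ⟨p, Finset.mem_union_left _ hp, h⟩
  · obtain ⟨p, hp⟩ := hne
    obtain ⟨hmin, hneg⟩ := hnew p hp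
    have hmem : p.seq ∈ missingSeqs I P := by
      refine ⟨⟨p, hmin.1, rfl⟩, ?_⟩
      rintro ⟨p', hp', hmin', hseq⟩
      have h1 := hmin'.2 p hmin.1 hseq.symm
      have h2 := I.reducedCost_sub Ω y hseq
      have h3 := hy.reducedCost_nonneg p' hp'
      linarith
    exact (hsub hmem).2 ⟨p, Finset.mem_union_right _ hp, hmin, rfl⟩

/-- The order of the components matters: an expansion deletes paths, so it may raise the number of
missing sequences, and resuming column generation resets the last component from 0 to 1. That
component accounts for the step that ends column generation. -/
theorem Invariant.progress_lt {zInt : MachinePath V →₀ ℝ} {s s' : I.State}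
    (h : Invariant C zInt s) (hstep : I.Step C s s') :
    (∃ z, s' = .returned z) ∨ progress s' < progress s := by
  cases hstep with
  | price N Ω P Pnew y hy hne hnew =>
    right
    have := ncard_missingSeqs_union_lt hy.1 hne fun p hp => (hnew p hp).2
    simp [progress, Prod.Lex.toLex_lt_toLex, this]
  | optimal N Ω P y z hy hz hnone =>
    right
    simp [progress, Prod.Lex.toLex_lt_toLex]
  -- A returned state is exempt: the measure before it may already be zero.
  | terminate N Ω P z helem hcuts => exact Or.inl ⟨z, rfl⟩
  | elementarity N Ω P z helem =>
    right
    have h : OptimizedInvariant C zInt N Ω P z := h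
    have := ncard_missingPairs_expand_lt
      (fun p hp => h.paths p (h.primal.1.support p hp)) helem
    simp [progress, Prod.Lex.toLex_lt_toLex, this]
  | integrality N Ω P z q helem hq hviol =>
    right
    have h : OptimizedInvariant C zInt N Ω P z := h
    have := ncard_missingSignatures_insert_lt (fun p hp => (h.paths p hp).1) h.primal.1 hviol
    simp [progress, Prod.Lex.toLex_lt_toLex, this]

theorem Invariant.terminates {zInt : MachinePath V →₀ ℝ} {s : I.State}
    (h : Invariant C zInt s) : I.Terminates C s := by
  refine ⟨?_, fun s' hs' => (h.reaches hs').exists_step⟩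
  rintro ⟨r, hr0, hr⟩
  have hinv : ∀ k, Invariant C zInt (r k) := by
    intro k
    induction k with
    | zero => rwa [hr0]
    | succ k ih => exact ih.step (hr k)
  obtain ⟨k, hk⟩ := WellFounded.not_rel_apply_succ (r := ((· < ·) : ℕ ×ₗ ℕ ×ₗ ℕ ×ₗ ℕ → _ → Prop))
    fun k => progress (r k)
  rcases (hinv k).progress_lt (hr k) with ⟨z, hz⟩ | hlt
  -- No step leaves a returned state, so an infinite run never contains one.
  · have := hr (k + 1)
    rw [hz] at this
    cases this
  · exact hk hlt

/-! ### Bounds -/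

/-- At the end of column generation, `z` is at least as good as all solutions over elementary paths. -/
theorem OptimizedInvariant.objective_le {zInt : MachinePath V →₀ ℝ} {N : V → Set V}
    {Ω : Finset I.Cut} {P : Finset (MachinePath V)} {z : MachinePath V →₀ ℝ}
    (h : OptimizedInvariant C zInt N Ω P z) {z' : MachinePath V →₀ ℝ}
    (hz' : I.RelaxFeasible I.elementaryPaths (Ω : Set I.Cut) z') :
    I.objective z ≤ I.objective z' := by
  obtain ⟨y, hy, hred⟩ := h.dual
  -- Strong duality holds over the finite set `P`; weak duality then applies over all elementary
  -- paths, since `y` prices out every ng-feasible path and not only those in `P`.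
  rw [I.objective_eq_dualObjective h.pathCost_nonneg h.primal hy]
  exact I.dualObjective_le_objective hz' hy.1.1 hy.1.2
    fun p hp => hred p (I.elementaryPaths_subset_ngPaths h.ng hp)

theorem OptimizedInvariant.relaxFeasible_elementaryPaths {zInt : MachinePath V →₀ ℝ}
    {N : V → Set V} {Ω : Finset I.Cut} {P : Finset (MachinePath V)} {z : MachinePath V →₀ ℝ}
    (h : OptimizedInvariant C zInt N Ω P z) (helem : I.UsesElementary z) {Ω' : Set I.Cut}
    (hcuts : ∀ q ∈ Ω', q.Satisfied z) : I.RelaxFeasible I.elementaryPaths Ω' z :=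
  h.primal.1.mono (fun p hp => ⟨(h.paths p (h.primal.1.support p hp)).1, helem p hp⟩) hcuts

/-- Without cuts, every solution over elementary paths is a valid competitor for the lower bound,
and `z` is itself one of them. -/
theorem OptimizedInvariant.relaxOpt_eq {zInt : MachinePath V →₀ ℝ} {N : V → Set V}
    {P : Finset (MachinePath V)} {z : MachinePath V →₀ ℝ}
    (h : OptimizedInvariant C zInt N ∅ P z) (helem : I.UsesElementary z) :
    I.RelaxFeasible I.elementaryPaths ∅ z ∧
      (I.objective z : EReal) = I.relaxOpt I.elementaryPaths := by
  have hz := h.relaxFeasible_elementaryPaths helem (Ω' := ∅) (by simp)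
  refine ⟨hz, le_antisymm (le_iInf₂ fun z' hz' => ?_) (iInf₂_le z hz)⟩
  exact EReal.coe_le_coe_iff.2 (h.objective_le (by simpa using hz'))

/-- Integer solutions satisfy all cuts, so they remain competitors whatever `Ω` is. Elementarity of
`z` plays no role here. -/
theorem OptimizedInvariant.objective_le_intOpt {zInt : MachinePath V →₀ ℝ} {N : V → Set V}
    {Ω : Finset I.Cut} {P : Finset (MachinePath V)} {z : MachinePath V →₀ ℝ}
    (h : OptimizedInvariant C zInt N Ω P z) :
    (I.objective z : EReal) ≤ I.intOpt I.elementaryPaths := by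
  refine le_iInf₂ fun z' hz' => EReal.coe_le_coe_iff.2 (h.objective_le ?_)
  have hz' : I.IntFeasible I.elementaryPaths z' := hz'
  exact hz'.1.mono hz'.1.support fun q _ => hz'.satisfied q

end ERSP

/-- Finite termination and bounds of column generation with adaptive ng-relaxations and lm-SRI cuts.
The cuts are separated over an arbitrary family `C`; with the empty family, Step 4 is never
executed, so that `∅` stands for the algorithm that consists of Steps 1-3. -/
theorem theorem3 {V : Type*} (I : ERSP.Instance V) (C : Set I.Cut)
    (N₀ : V → Set V) (hN₀ : I.IsNgNeighborhood N₀)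
    (P₀ : Finset (ERSP.MachinePath V)) (hP₀ : ∀ p ∈ P₀, p ∈ I.ngPaths N₀)
    (hfeas : ∃ z, I.IntFeasible (P₀ : Set (ERSP.MachinePath V)) z) :
    -- the algorithm terminates finitely, and so does its restriction to Steps 1-3
    I.Terminates C (.generating N₀ ∅ P₀) ∧
    I.Terminates ∅ (.generating N₀ ∅ P₀) ∧
    -- Steps 1-3 return an optimal solution of the elementary relaxation
    (∀ z, I.Reaches ∅ (.generating N₀ ∅ P₀) (.returned z) →
      I.RelaxFeasible I.elementaryPaths ∅ z ∧
        (I.objective z : EReal) = I.relaxOpt I.elementaryPaths) ∧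
    -- the same holds in the full algorithm as soon as Steps 1-3 have led to elementary paths,
    -- before any cut has been added
    (∀ N P z, I.Reaches C (.generating N₀ ∅ P₀) (.optimized N ∅ P z) → I.UsesElementary z →
      I.RelaxFeasible I.elementaryPaths ∅ z ∧
        (I.objective z : EReal) = I.relaxOpt I.elementaryPaths) ∧
    -- Steps 1-4 return a solution whose value lies between the two bounds
    (∀ z, I.Reaches C (.generating N₀ ∅ P₀) (.returned z) →
      I.RelaxFeasible I.elementaryPaths C z ∧
        I.relaxOpt I.elementaryPaths ≤ (I.objective z : EReal) ∧
        (I.objective z : EReal) ≤ I.intOpt I.elementaryPaths) := by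
  obtain ⟨zInt, hInt⟩ := hfeas
  have hinit : ∀ D : Set I.Cut, ERSP.Invariant D zInt (.generating N₀ ∅ P₀) :=
    fun D => ⟨hN₀, by simp, hP₀, hInt⟩
  refine ⟨(hinit C).terminates, (hinit ∅).terminates, ?_, ?_, ?_⟩
  · intro z hz
    obtain ⟨⟨N, Ω, P, h⟩, helem, -⟩ := (hinit ∅).reaches hz
    -- All cuts ever added belong to the separated family, which is empty here.
    obtain rfl : Ω = ∅ := Finset.eq_empty_of_forall_notMem fun q hq => h.cuts q hq
    exact h.relaxOpt_eq helem
  · intro N P z hz helem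
    have h : ERSP.OptimizedInvariant C zInt N ∅ P z := (hinit C).reaches hz
    exact h.relaxOpt_eq helem
  · intro z hz
    obtain ⟨⟨N, Ω, P, h⟩, helem, hcuts⟩ := (hinit C).reaches hz
    refine ⟨h.relaxFeasible_elementaryPaths helem hcuts, ?_, h.objective_le_intOpt⟩
    exact iInf₂_le z (h.relaxFeasible_elementaryPaths helem (Ω' := ∅) (by simp))
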